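/- Let $\mathcal A$ be a unital complex Banach algebra and let $\varphi:\mathcal A\to\mathbb C$ be a continuous linear functional with $\varphi(1)=1$. For $a\in\mathcal A$ put $G_a(z)=\varphi((z1-a)^{-1})$; let $K_a$ be the inverse of $G_a$ near $0$, i.e. the germ of a function defined for $z\neq 0$ near $0$ with $K_a(z)\to\infty$ as $z\to 0$ and $G_a(K_a(z))=z$. For $b\in\mathcal A$ with $\varphi(b)\ne 0$ put $\psi_b(s)=\varphi((1-sb)^{-1})-1$ and let $\mathcal X_b$ be the inverse of $\psi_b$ near $0$, i.e. the germ with $\mathcal X_b(w)\to 0$ as $w\to 0$ and $\psi_b(\mathcal X_b(w))=w$. Put $F_{a,b}(t,s)=\varphi((t1-a)^{-1}(1-sb)^{-1})$ and, if $\varphi(b)\ne 0$, define the partial bi-free $T$-transform, for $z,w\in\mathbb C\setminus\{0\}$ near $0$, by $$T_{a,b}(z,w)=\frac{w+1}{w}\left(1-\frac{z}{F_{a,b}(K_a(z),\mathcal X_b(w))}\right).$$ Two two-faced pairs $(a_1,b_1)$ and $(a_2,b_2)$ in $\mathcal A$ (left variables $a_k$, right variables $b_k$) are bi-free if there are complex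 vector spaces $X_k=\mathbb C\xi_k\oplus X_k^\circ$ with specified vectors $\xi_k$ and linear operators $L_k,R_k$ on $X_k$ ($k=1,2$) such that, for every polynomial $P$ in four noncommuting variables, $\varphi(P(a_1,a_2,b_1,b_2))$ equals the coefficient of $\xi$ in $P(\lambda_1(L_1),\lambda_2(L_2),\rho_1(R_1),\rho_2(R_2))\xi$. Here $X=\mathbb C\xi\oplus\bigoplus_{n\ge1}\bigoplus_{k_1\neq k_2\neq\cdots\neq k_n}X^\circ_{k_1}\otimes\cdots\otimes X^\circ_{k_n}$ is the free product of $(X_1,\xi_1)$ and $(X_2,\xi_2)$, and $\lambda_k(L)=L\otimes 1$, $\rho_k(R)=1\otimes R$ with respect to the natural identifications $X\cong X_k\otimes X(\ell,k)$ and $X\cong X(r,k)\otimes X_k$, where $X(\ell,k)$ (resp. $X(r,k)$) is the sum of $\mathbb C\xi$ and the summands of $X$ with $k_1\neq k$ (resp. $k_n\ne k$). **Theorem 3.1.** Let $(a_1,b_1)$ and $(a_2,b_2)$ be bi-free two-faced pairs in $(\mathcal A,\varphi)$ with $\varphi(b_1)\neq0$ and $\varphi(b_2)\ne0$. Then $\varphi(b_1b_2)\neq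 0$ and $$T_{a_1+a_2,\,b_1b_2}(z,w)=T_{a_1,b_1}(z,w)\,T_{a_2,b_2}(z,w)$$ for all $(z,w)\in(\mathbb C\setminus\{0\})^2$ sufficiently near $(0,0)$. -/

import Mathlib

open Filter Topology

universe u v w

noncomputable section

namespace BiFree

/-! ### Vector spaces with a specified vector and their free product -/

/-- A complex vector space with a specified vector `vec` and a specified complement `ker state` of
the line through `vec`; `state` is the functional reading off the coefficient of `vec`. -/
structure PointedSpace : Type (v + 1) where
  carrier : Type v
  [addCommGroup : AddCommGroup carrier]
  [module : Module ℂ carrier]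
  vec : carrier
  state : carrier →ₗ[ℂ] ℂ
  state_vec : state vec = 1

attribute [instance] PointedSpace.addCommGroup PointedSpace.module

/-- The specified complement of the line through the specified vector. -/
abbrev PointedSpace.compl (E : PointedSpace.{v}) : Submodule ℂ E.carrier := LinearMap.ker E.state

/-- The projection onto the complement along the specified vector. -/
def PointedSpace.proj (E : PointedSpace.{v}) : E.carrier →ₗ[ℂ] E.compl :=
  LinearMap.codRestrict E.compl (LinearMap.id - E.state.smulRight E.vec) (fun x => by
    simp [LinearMap.mem_ker, E.state_vec])

theorem PointedSpace.coe_proj (E : PointedSpace.{v}) (x : E.carrier) :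
    (E.proj x : E.carrier) = x - E.state x • E.vec := rfl

section FreeProduct

variable {κ : Type w} [DecidableEq κ] (X : κ → PointedSpace.{v})

/-- The direct sum of the complements; the free product is built inside its tensor algebra. -/
abbrev Letters : Type (max w v) := DirectSum κ (fun k => (X k).compl)

abbrev Tensors : Type (max w v) := TensorAlgebra ℂ (Letters X)

/-- A vector of the `k`-th complement as a tensor of degree one. -/
def letter (k : κ) : (X k).compl →ₗ[ℂ] Tensors X :=
  TensorAlgebra.ι ℂ ∘ₗ DirectSum.lof ℂ κ (fun k => (X k).compl) k

/-- The copy of the `k`-th space inside the tensors: the specified vector goes to the empty tensor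
`1`, the complement to the tensors of degree one. -/
def embed (k : κ) : (X k).carrier →ₗ[ℂ] Tensors X :=
  (X k).state.smulRight (1 : Tensors X) + letter X k ∘ₗ (X k).proj

/-- The elementary tensor `x₁ ⊗ ⋯ ⊗ xₙ`, where `xᵢ` lies in the complement with index `kᵢ`. -/
def tensorWord (l : List (Σ k, (X k).compl)) : Tensors X :=
  (l.map fun p => letter X p.1 p.2).prod

/-- Neighbouring indices of the word are different. -/
def Alternating (l : List (Σ k, (X k).compl)) : Prop := (l.map Sigma.fst).IsChain (· ≠ ·)

/-- The underlying space of the free product: the span `ℂ 1 ⊕ ⨁ X°_{k₁} ⊗ ⋯ ⊗ X°_{kₙ}`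
(`k₁ ≠ k₂ ≠ ⋯ ≠ kₙ`, `n ≥ 1`) of the alternating elementary tensors. -/
def freeSpace : Submodule ℂ (Tensors X) :=
  Submodule.span ℂ (tensorWord X '' {l | Alternating X l})

theorem one_mem_freeSpace : (1 : Tensors X) ∈ freeSpace X :=
  Submodule.subset_span ⟨[], by simp [Alternating], by simp [tensorWord]⟩

/-- The free product of vector spaces with specified vectors. Its specified vector is the empty
tensor and its functional reads off the degree-zero part. -/
def freeProduct : PointedSpace.{max w v} where
  carrier := freeSpace X
  vec := ⟨1, one_mem_freeSpace X⟩
  state := (TensorAlgebra.algebraMapInv (R := ℂ) (M := Letters X)).toLinearMap ∘ₗ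
    (freeSpace X).subtype
  state_vec := by simp

variable {X}

/-- For `v` of degree one, the value at `v` of the left action of `T`: the component `v_k` is
replaced by `T v_k`, the remaining part `v'` by `T ξ_k ⊗ v'`. -/
def leftLetter (k : κ) (T : Module.End ℂ (X k).carrier) : Letters X →ₗ[ℂ] Tensors X :=
  (embed X k ∘ₗ T ∘ₗ (X k).compl.subtype) ∘ₗ
      DirectSum.component ℂ κ (fun k => (X k).compl) k +
    LinearMap.mulLeft ℂ (embed X k (T (X k).vec)) ∘ₗ TensorAlgebra.ι ℂ ∘ₗ
      (LinearMap.id - DirectSum.lof ℂ κ (fun k => (X k).compl) k ∘ₗ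
        DirectSum.component ℂ κ (fun k => (X k).compl) k)

/-- The mirror image of `leftLetter`. -/
def rightLetter (k : κ) (T : Module.End ℂ (X k).carrier) : Letters X →ₗ[ℂ] Tensors X :=
  (embed X k ∘ₗ T ∘ₗ (X k).compl.subtype) ∘ₗ
      DirectSum.component ℂ κ (fun k => (X k).compl) k +
    LinearMap.mulRight ℂ (embed X k (T (X k).vec)) ∘ₗ TensorAlgebra.ι ℂ ∘ₗ
      (LinearMap.id - DirectSum.lof ℂ κ (fun k => (X k).compl) k ∘ₗ
        DirectSum.component ℂ κ (fun k => (X k).compl) k)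

def leftMatrix (k : κ) (T : Module.End ℂ (X k).carrier) :
    Letters X →ₗ[ℂ] Matrix (Fin 2) (Fin 2) (Tensors X) where
  toFun v := !![TensorAlgebra.ι ℂ v, 0; leftLetter k T v, 0]
  map_add' v v' := by ext i j; fin_cases i <;> fin_cases j <;> simp
  map_smul' c v := by ext i j; fin_cases i <;> fin_cases j <;> simp

def rightMatrix (k : κ) (T : Module.End ℂ (X k).carrier) :
    Letters X →ₗ[ℂ] Matrix (Fin 2) (Fin 2) (Tensors X) where
  toFun v := !![TensorAlgebra.ι ℂ v, rightLetter k T v; 0, 0]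
  map_add' v v' := by ext i j; fin_cases i <;> fin_cases j <;> simp
  map_smul' c v := by ext i j; fin_cases i <;> fin_cases j <;> simp

/-- The linear map with `1 ↦ T ξ_k` and `v ⊗ u ↦ leftLetter k T v ⊗ u`
(see `leftMap_one`, `leftMap_ι_mul`). -/
def leftMap (k : κ) (T : Module.End ℂ (X k).carrier) : Tensors X →ₗ[ℂ] Tensors X :=
  (TensorAlgebra.algebraMapInv (R := ℂ) (M := Letters X)).toLinearMap.smulRight
      (embed X k (T (X k).vec)) +
    Matrix.entryLinearMap ℂ (Tensors X) 1 0 ∘ₗ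
      (TensorAlgebra.lift ℂ (leftMatrix k T)).toLinearMap

/-- The linear map with `1 ↦ T ξ_k` and `u ⊗ v ↦ u ⊗ rightLetter k T v`
(see `rightMap_one`, `rightMap_mul_ι`). -/
def rightMap (k : κ) (T : Module.End ℂ (X k).carrier) : Tensors X →ₗ[ℂ] Tensors X :=
  (TensorAlgebra.algebraMapInv (R := ℂ) (M := Letters X)).toLinearMap.smulRight
      (embed X k (T (X k).vec)) +
    Matrix.entryLinearMap ℂ (Tensors X) 0 1 ∘ₗ
      (TensorAlgebra.lift ℂ (rightMatrix k T)).toLinearMap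

theorem leftMap_one (k : κ) (T : Module.End ℂ (X k).carrier) :
    leftMap k T 1 = embed X k (T (X k).vec) := by
  simp [leftMap]

theorem rightMap_one (k : κ) (T : Module.End ℂ (X k).carrier) :
    rightMap k T 1 = embed X k (T (X k).vec) := by
  simp [rightMap]

theorem lift_leftMatrix (k : κ) (T : Module.End ℂ (X k).carrier) (u : Tensors X) :
    TensorAlgebra.lift ℂ (leftMatrix k T) u 0 0 = u ∧
      TensorAlgebra.lift ℂ (leftMatrix k T) u 0 1 = 0 := by
  induction u using TensorAlgebra.induction with
  | algebraMap r => simp [Matrix.algebraMap_matrix_apply]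
  | ι v => simp [leftMatrix]
  | mul a b ha hb => simp [Matrix.mul_apply, Fin.sum_univ_two, ha, hb]
  | add a b ha hb => simp [ha, hb]

theorem lift_rightMatrix (k : κ) (T : Module.End ℂ (X k).carrier) (u : Tensors X) :
    TensorAlgebra.lift ℂ (rightMatrix k T) u 0 0 = u ∧
      TensorAlgebra.lift ℂ (rightMatrix k T) u 1 0 = 0 := by
  induction u using TensorAlgebra.induction with
  | algebraMap r => simp [Matrix.algebraMap_matrix_apply]
  | ι v => simp [rightMatrix]
  | mul a b ha hb => simp [Matrix.mul_apply, Fin.sum_univ_two, ha, hb]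
  | add a b ha hb => simp [ha, hb]

theorem leftMap_ι_mul (k : κ) (T : Module.End ℂ (X k).carrier) (v : Letters X) (u : Tensors X) :
    leftMap k T (TensorAlgebra.ι ℂ v * u) = leftLetter k T v * u := by
  have h := (lift_leftMatrix k T u).1
  simp [leftMap, TensorAlgebra.algebraMapInv, Matrix.mul_apply, Fin.sum_univ_two, h]
  simp [leftMatrix]

theorem rightMap_mul_ι (k : κ) (T : Module.End ℂ (X k).carrier) (v : Letters X) (u : Tensors X) :
    rightMap k T (u * TensorAlgebra.ι ℂ v) = u * rightLetter k T v := by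
  have h := (lift_rightMatrix k T u).1
  simp [rightMap, TensorAlgebra.algebraMapInv, Matrix.mul_apply, Fin.sum_univ_two, h]
  simp [rightMatrix]

theorem leftMap_letter_same (k : κ) (T : Module.End ℂ (X k).carrier) (x : (X k).compl)
    (u : Tensors X) : leftMap k T (letter X k x * u) = embed X k (T x) * u := by
  simp [letter, leftMap_ι_mul, leftLetter]

theorem rightMap_letter_same (k : κ) (T : Module.End ℂ (X k).carrier) (x : (X k).compl)
    (u : Tensors X) : rightMap k T (u * letter X k x) = u * embed X k (T x) := by
  simp [letter, rightMap_mul_ι, rightLetter]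

theorem leftMap_letter_ne {j k : κ} (hjk : j ≠ k) (T : Module.End ℂ (X k).carrier)
    (x : (X j).compl) (u : Tensors X) :
    leftMap k T (letter X j x * u) = embed X k (T (X k).vec) * (letter X j x * u) := by
  simp [letter, leftMap_ι_mul, leftLetter, DirectSum.component.of, hjk, mul_assoc]

theorem rightMap_letter_ne {j k : κ} (hjk : j ≠ k) (T : Module.End ℂ (X k).carrier)
    (x : (X j).compl) (u : Tensors X) :
    rightMap k T (u * letter X j x) = u * letter X j x * embed X k (T (X k).vec) := by
  simp [letter, rightMap_mul_ι, rightLetter, DirectSum.component.of, hjk, mul_assoc]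

theorem tensorWord_cons (p : Σ k, (X k).compl) (l : List (Σ k, (X k).compl)) :
    tensorWord X (p :: l) = letter X p.1 p.2 * tensorWord X l := by
  simp [tensorWord]

theorem tensorWord_concat (p : Σ k, (X k).compl) (l : List (Σ k, (X k).compl)) :
    tensorWord X (l ++ [p]) = tensorWord X l * letter X p.1 p.2 := by
  simp [tensorWord]

theorem tensorWord_mem {l : List (Σ k, (X k).compl)} (hl : Alternating X l) :
    tensorWord X l ∈ freeSpace X :=
  Submodule.subset_span ⟨l, hl, rfl⟩

theorem embed_mul_word_mem {k : κ} (y : (X k).carrier) {l : List (Σ k, (X k).compl)}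
    (hl : Alternating X l) (h : Alternating X (⟨k, (X k).proj y⟩ :: l)) :
    embed X k y * tensorWord X l ∈ freeSpace X := by
  have h1 := tensorWord_mem h
  rw [tensorWord_cons] at h1
  simpa [embed, add_mul] using
    (freeSpace X).add_mem ((freeSpace X).smul_mem ((X k).state y) (tensorWord_mem hl)) h1

theorem word_mul_embed_mem {k : κ} (y : (X k).carrier) {l : List (Σ k, (X k).compl)}
    (hl : Alternating X l) (h : Alternating X (l ++ [⟨k, (X k).proj y⟩])) :
    tensorWord X l * embed X k y ∈ freeSpace X := by
  have h1 := tensorWord_mem h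
  rw [tensorWord_concat] at h1
  simpa [embed, mul_add] using
    (freeSpace X).add_mem ((freeSpace X).smul_mem ((X k).state y) (tensorWord_mem hl)) h1

theorem leftMap_mem (k : κ) (T : Module.End ℂ (X k).carrier) :
    ∀ u ∈ freeSpace X, leftMap k T u ∈ freeSpace X := by
  intro u hu
  induction hu using Submodule.span_induction with
  | mem u hu =>
    obtain ⟨l, hl, rfl⟩ := hu
    rcases l with _ | ⟨⟨j, x⟩, l⟩
    · simpa [tensorWord, leftMap_one] using
        embed_mul_word_mem (T (X k).vec) (l := []) hl (by simp [Alternating])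
    · rcases eq_or_ne j k with rfl | hjk
      · rw [tensorWord_cons, leftMap_letter_same]
        refine embed_mul_word_mem _ ?_ (by simpa [Alternating] using hl)
        simp only [Set.mem_ofPred_eq, Alternating, List.map_cons] at hl ⊢
        exact hl.tail
      · rw [tensorWord_cons, leftMap_letter_ne hjk, ← tensorWord_cons ⟨j, x⟩ l]
        refine embed_mul_word_mem _ hl ?_
        simp only [Set.mem_ofPred_eq, Alternating, List.map_cons] at hl ⊢
        exact List.IsChain.cons_cons hjk.symm hl
  | zero => simp
  | add a b _ _ ha hb => rw [map_add]; exact (freeSpace X).add_mem ha hb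
  | smul c a _ ha => rw [map_smul]; exact (freeSpace X).smul_mem c ha

theorem rightMap_mem (k : κ) (T : Module.End ℂ (X k).carrier) :
    ∀ u ∈ freeSpace X, rightMap k T u ∈ freeSpace X := by
  intro u hu
  induction hu using Submodule.span_induction with
  | mem u hu =>
    obtain ⟨l, hl, rfl⟩ := hu
    rcases List.eq_nil_or_concat l with rfl | ⟨l, ⟨j, x⟩, rfl⟩
    · simpa [tensorWord, rightMap_one] using
        word_mul_embed_mem (T (X k).vec) (l := []) hl (by simp [Alternating])
    · rw [List.concat_eq_append] at hl ⊢
      rcases eq_or_ne j k with rfl | hjk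
      · rw [tensorWord_concat, rightMap_letter_same]
        refine word_mul_embed_mem _ ?_ (by simpa [Alternating] using hl)
        simp only [Set.mem_ofPred_eq, Alternating, List.map_append] at hl ⊢
        exact hl.left_of_append
      · rw [tensorWord_concat, rightMap_letter_ne hjk, ← tensorWord_concat ⟨j, x⟩ l]
        refine word_mul_embed_mem _ hl ?_
        simp only [Set.mem_ofPred_eq, Alternating, List.map_append] at hl ⊢
        refine List.IsChain.append hl (by simp) ?_
        simp [hjk]
  | zero => simp
  | add a b _ _ ha hb => rw [map_add]; exact (freeSpace X).add_mem ha hb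
  | smul c a _ ha => rw [map_smul]; exact (freeSpace X).smul_mem c ha

/-- The left representation `λ_k` of the operators on the `k`-th space on the free product:
`T ⊗ 1` with respect to the decomposition of the free product as `X_k ⊗ X(ℓ, k)`, where `X(ℓ, k)`
is spanned by the alternating tensors that do not begin in the `k`-th complement. -/
def leftRep (k : κ) (T : Module.End ℂ (X k).carrier) : Module.End ℂ (freeProduct X).carrier :=
  (leftMap k T).restrict (leftMap_mem k T)

/-- The right representation `ρ_k`: `1 ⊗ T` with respect to the decomposition of the free product
as `X(r, k) ⊗ X_k`, where `X(r, k)` is spanned by the alternating tensors that do not end in the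
`k`-th complement. -/
def rightRep (k : κ) (T : Module.End ℂ (X k).carrier) : Module.End ℂ (freeProduct X).carrier :=
  (rightMap k T).restrict (rightMap_mem k T)

end FreeProduct

/-! ### Bi-freeness -/

/-- The joint distribution of the families `a`, `b` of left and right variables in `(A, φ)`, as a
functional on noncommutative polynomials. -/
def jointDistribution {A : Type u} [Ring A] [Algebra ℂ A] (φ : A →ₗ[ℂ] ℂ) {κ : Type w}
    (a b : κ → A) : FreeAlgebra ℂ (κ ⊕ κ) →ₗ[ℂ] ℂ :=
  φ ∘ₗ (FreeAlgebra.lift ℂ (Sum.elim a b)).toLinearMap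

/-- The vector functional of the specified vector on the operators of a pointed space. -/
def vectorState (E : PointedSpace.{v}) : Module.End ℂ E.carrier →ₗ[ℂ] ℂ :=
  E.state ∘ₗ LinearMap.applyₗ E.vec

/-- Bi-freeness of the two-faced pairs `(a k, b k)`: there are spaces with specified vectors `X k`
and operators `L k`, `R k` on them such that the variables `a k`, `b k` have the same joint
distribution as the operators `λ_k (L k)`, `ρ_k (R k)` on the free product of the `X k`.
(A unital homomorphism from the face `ℂ⟨x⟩` into the operators on `X k` is the same as an operator
on `X k`.) -/
def IsBiFree {A : Type u} [Ring A] [Algebra ℂ A] (φ : A →ₗ[ℂ] ℂ) {κ : Type w} [DecidableEq κ]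
    (a b : κ → A) : Prop :=
  ∃ (X : κ → PointedSpace.{v}) (L R : ∀ k, Module.End ℂ (X k).carrier),
    jointDistribution φ a b = jointDistribution (vectorState (freeProduct X))
      (fun k => leftRep k (L k)) (fun k => rightRep k (R k))

/-! ### Transforms -/

section Transforms

variable {A : Type u} [NormedRing A] [NormedAlgebra ℂ A] (φ : A →L[ℂ] ℂ)

/-- `G_a(z) = φ((z1 - a)⁻¹)`. -/
def cauchyG (a : A) (z : ℂ) : ℂ := φ (Ring.inverse (z • (1 : A) - a))

/-- `ψ_b(s) = φ((1 - sb)⁻¹) - 1`. -/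
def psi (b : A) (s : ℂ) : ℂ := φ (Ring.inverse (1 - s • b)) - 1

/-- `F_{a,b}(t,s) = φ((t1 - a)⁻¹ (1 - sb)⁻¹)`. -/
def mixedF (a b : A) (t s : ℂ) : ℂ :=
  φ (Ring.inverse (t • (1 : A) - a) * Ring.inverse (1 - s • b))

/-- `K` is, as a germ at `0`, the inverse of `G_a` (which is a local bijection from a neighbourhood
of `∞` onto a neighbourhood of `0`). -/
def IsInverseG (a : A) (K : ℂ → ℂ) : Prop :=
  Tendsto K (𝓝[≠] 0) (Bornology.cobounded ℂ) ∧ ∀ᶠ z in 𝓝[≠] 0, cauchyG φ a (K z) = z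

/-- `χ` is, as a germ at `0`, the inverse of `ψ_b` (which vanishes at `0`). -/
def IsInversePsi (b : A) (χ : ℂ → ℂ) : Prop :=
  Tendsto χ (𝓝 0) (𝓝 0) ∧ ∀ᶠ w in 𝓝 0, psi φ b (χ w) = w

variable [CompleteSpace A]

theorem hasStrictDerivAt_h (a : A) :
    HasStrictDerivAt (fun t : ℂ => φ (Ring.inverse (1 - t • a))) (φ a) 0 := by
  have h1 : HasStrictDerivAt (fun t : ℂ => 1 - t • a) (-a) 0 := by
    simpa using ((hasStrictDerivAt_id (0 : ℂ)).smul_const a).const_sub (1 : A)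
  have h2 := hasStrictFDerivAt_ringInverse (𝕜 := ℂ) (1 : Aˣ)
  rw [show ((1 : Aˣ) : A) = 1 - (0 : ℂ) • a by simp] at h2
  have h3 := HasStrictFDerivAt.comp_hasStrictDerivAt (0 : ℂ)
    (φ.hasStrictFDerivAt (x := Ring.inverse (1 - (0 : ℂ) • a)))
    (h2.comp_hasStrictDerivAt (0 : ℂ) h1)
  have h4 : φ ((-((ContinuousLinearMap.mulLeftRight ℂ A) ↑(1 : Aˣ)⁻¹) ↑(1 : Aˣ)⁻¹) (-a)) = φ a := by
    simp
  rw [h4] at h3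
  exact h3

theorem exists_isInversePsi (hφ : φ 1 = 1) (b : A) (hb : φ b ≠ 0) :
    ∃ χ : ℂ → ℂ, IsInversePsi φ b χ := by
  have h : HasStrictDerivAt (psi φ b) (φ b) 0 := (hasStrictDerivAt_h φ b).sub_const 1
  have h0 : psi φ b 0 = 0 := by simp [psi, hφ]
  refine ⟨h.localInverse (psi φ b) (φ b) 0 hb, ?_, ?_⟩
  · have h1 := (h.to_localInverse hb).hasDerivAt.continuousAt.tendsto
    have h2 : h.localInverse (psi φ b) (φ b) 0 hb (psi φ b 0) = 0 :=
      (h.hasStrictFDerivAt_equiv hb).localInverse_apply_image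
    rwa [h2, h0] at h1
  · have h1 := (h.hasStrictFDerivAt_equiv hb).eventually_right_inverse
    rwa [h0] at h1

theorem exists_isInverseG (hφ : φ 1 = 1) (a : A) : ∃ K : ℂ → ℂ, IsInverseG φ a K := by
  have h : HasStrictDerivAt (fun t : ℂ => t * φ (Ring.inverse (1 - t • a))) 1 0 := by
    have h1 := (hasStrictDerivAt_id (0 : ℂ)).mul (hasStrictDerivAt_h φ a)
    have h2 : (1 : ℂ) * φ (Ring.inverse (1 - (0 : ℂ) • a)) + id (0 : ℂ) * φ a = 1 := by simp [hφ]
    rw [h2] at h1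
    exact h1
  set g : ℂ → ℂ := fun t => t * φ (Ring.inverse (1 - t • a)) with hg
  have h0 : g 0 = 0 := by simp [hg]
  set k := h.localInverse g 1 0 one_ne_zero with hk
  have hk0 : Tendsto k (𝓝 0) (𝓝 0) := by
    have h1 := (h.to_localInverse one_ne_zero).hasDerivAt.continuousAt.tendsto
    have h2 : h.localInverse g 1 0 one_ne_zero (g 0) = 0 :=
      (h.hasStrictFDerivAt_equiv one_ne_zero).localInverse_apply_image
    rwa [h2, h0] at h1
  have hgk : ∀ᶠ z in 𝓝 0, g (k z) = z := by
    have h1 := (h.hasStrictFDerivAt_equiv one_ne_zero).eventually_right_inverse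
    rwa [h0] at h1
  have hgk' : ∀ᶠ z in 𝓝[≠] 0, g (k z) = z ∧ k z ≠ 0 := by
    filter_upwards [hgk.filter_mono nhdsWithin_le_nhds, self_mem_nhdsWithin] with z hz hz0
    refine ⟨hz, fun hkz => hz0 ?_⟩
    rw [Set.mem_singleton_iff, ← hz, hkz, h0]
  refine ⟨fun z => (k z)⁻¹, ?_, ?_⟩
  · refine tendsto_inv₀_nhdsNE_zero.comp (tendsto_nhdsWithin_iff.2 ⟨?_, ?_⟩)
    · exact hk0.mono_left nhdsWithin_le_nhds
    · filter_upwards [hgk'] with z hz using hz.2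
  · filter_upwards [hgk'] with z hz
    have hu : (k z)⁻¹ • (1 : A) - a = ((k z)⁻¹ • (1 : A)) * (1 - k z • a) := by
      rw [smul_mul_assoc, one_mul, smul_sub, smul_smul, inv_mul_cancel₀ hz.2, one_smul]
    have h1 : ((k z)⁻¹ • (1 : A)) * (k z • (1 : A)) = 1 := by
      rw [smul_mul_smul_comm, inv_mul_cancel₀ hz.2, one_smul, one_mul]
    have h2 : (k z • (1 : A)) * ((k z)⁻¹ • (1 : A)) = 1 := by
      rw [smul_mul_smul_comm, mul_inv_cancel₀ hz.2, one_smul, one_mul]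
    have hc : IsUnit ((k z)⁻¹ • (1 : A)) := ⟨⟨_, _, h1, h2⟩, rfl⟩
    have hi : Ring.inverse ((k z)⁻¹ • (1 : A)) = k z • (1 : A) := by
      have h3 := Ring.inverse_mul_cancel _ hc
      calc _ = Ring.inverse ((k z)⁻¹ • (1 : A)) * (((k z)⁻¹ • (1 : A)) * (k z • (1 : A))) := by
            rw [h1, mul_one]
        _ = _ := by rw [← mul_assoc, h3, one_mul]
    have hgz := hz.1
    rw [cauchyG, hu, Ring.inverse_mul (Or.inl hc), hi, mul_smul_comm, mul_one, map_smul,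
      smul_eq_mul]
    exact hgz

/-- `K_a`, the inverse of `G_a` near `0`. -/
def invG (hφ : φ 1 = 1) (a : A) : ℂ → ℂ := (exists_isInverseG φ hφ a).choose

/-- `𝒳_b`, the inverse of `ψ_b` near `0`, defined when `φ(b) ≠ 0`. -/
def invPsi (hφ : φ 1 = 1) (b : A) (hb : φ b ≠ 0) : ℂ → ℂ := (exists_isInversePsi φ hφ b hb).choose

/-- The partial bi-free `T`-transform, defined when `φ(b) ≠ 0`. -/
def tTransform (hφ : φ 1 = 1) (a b : A) (hb : φ b ≠ 0) (z w : ℂ) : ℂ :=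
  (w + 1) / w * (1 - z / mixedF φ a b (invG φ hφ a z) (invPsi φ hφ b hb w))

end Transforms

end BiFree

end


/-!
At `t = K_a(z)` and `s = 𝒳_b(w)` the resolvents are `(t1 - a)⁻¹ = z(1 + α)` and
`(1 - sb)⁻¹ = (1 + w)(1 + β)` with `φ(α) = φ(β) = 0`. Write `c = (1 + w) / w` and
`altSeries c x = (1 + x₁)(1 - c x₀x₁)⁻¹(1 + x₀)` for the sum of the alternating words in `x₀, x₁`,
where a word is weighted by `c` to the number of its factors `x₀x₁`. Then `z · altSeries 1 α` is a
resolvent of `a₀ + a₁` and `(1 + w) · altSeries c β` one of `b₀b₁`, and their parameters are again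
`K(z)` and `𝒳(w)`. By bi-freeness an alternating word in `α` times an alternating word in `β`
has expectation `∏ φ(αₖβₖ)` if the two words agree and `0` otherwise. Hence
`φ(altSeries 1 α * altSeries c β) = altSeries c P` with `Pₖ = φ(αₖβₖ)`, so that the `T`-transforms
of the pairs are `(1 + cPₖ) / (1 + Pₖ)`, and their product is that of `(a₀ + a₁, b₀b₁)` because
`1 + c(altSeries c P - 1) = (1 + cP₀)(1 + cP₁) / (1 - cP₀P₁)`.
-/

namespace BiFree

section FreeProduct

namespace PointedSpace

theorem proj_vec (E : PointedSpace.{v}) : E.proj E.vec = 0 := by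
  ext
  simp [coe_proj, E.state_vec]

theorem coe_proj_of_state_eq_zero {E : PointedSpace.{v}} {x : E.carrier} (hx : E.state x = 0) :
    (E.proj x : E.carrier) = x := by
  simp [coe_proj, hx]

theorem state_smul_vec_add_proj (E : PointedSpace.{v}) (x : E.carrier) :
    E.state x • E.vec + (E.proj x : E.carrier) = x := by
  simp [coe_proj]

end PointedSpace

variable {κ : Type w} {X : κ → PointedSpace.{v}}

theorem Alternating.head?_ne {k : κ} {x : (X k).compl} {l : List (Σ k, (X k).compl)}
    (h : Alternating X (⟨k, x⟩ :: l)) : ∀ p ∈ l.head?, p.1 ≠ k := by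
  intro p hp
  rw [Alternating, List.map_cons, List.isChain_cons] at h
  exact (h.1 p.1 (by simpa using ⟨p.2, p.2.2, hp⟩)).symm

theorem Alternating.getLast?_ne {k : κ} {x : (X k).compl} {l : List (Σ k, (X k).compl)}
    (h : Alternating X (l ++ [⟨k, x⟩])) : ∀ p ∈ l.getLast?, p.1 ≠ k := by
  intro p hp
  rw [Alternating, List.map_append, List.isChain_append] at h
  exact h.2.2 p.1 (by simpa using ⟨p.2, p.2.2, hp⟩) k (by simp)

variable [DecidableEq κ]

theorem embed_apply (k : κ) (y : (X k).carrier) :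
    embed X k y = (X k).state y • 1 + letter X k ((X k).proj y) := rfl

theorem embed_vec (k : κ) : embed X k (X k).vec = 1 := by
  simp [embed_apply, PointedSpace.proj_vec, (X k).state_vec]

theorem embed_of_state_eq_zero {k : κ} {y : (X k).carrier} (hy : (X k).state y = 0) :
    embed X k y = letter X k ((X k).proj y) := by
  simp [embed_apply, hy]

theorem embed_coe (k : κ) (x : (X k).compl) : embed X k x = letter X k x := by
  rw [embed_of_state_eq_zero x.2, Subtype.ext (PointedSpace.coe_proj_of_state_eq_zero x.2)]

theorem algebraMapInv_letter_mul (k : κ) (x : (X k).compl) (u : Tensors X) :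
    TensorAlgebra.algebraMapInv (letter X k x * u) = 0 := by
  simp [letter, TensorAlgebra.algebraMapInv]

theorem algebraMapInv_embed (k : κ) (y : (X k).carrier) :
    TensorAlgebra.algebraMapInv (embed X k y) = (X k).state y := by
  simpa [embed_apply] using algebraMapInv_letter_mul k ((X k).proj y) 1

theorem leftMap_tensorWord (k : κ) (T : Module.End ℂ (X k).carrier)
    {l : List (Σ k, (X k).compl)} (hl : ∀ p ∈ l.head?, p.1 ≠ k) :
    leftMap k T (tensorWord X l) = embed X k (T (X k).vec) * tensorWord X l := by
  rcases l with _ | ⟨⟨j, x⟩, l⟩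
  · simp [tensorWord, leftMap_one]
  · rw [tensorWord_cons]
    exact leftMap_letter_ne (hl ⟨j, x⟩ (by simp)) T x _

theorem rightMap_tensorWord (k : κ) (T : Module.End ℂ (X k).carrier)
    {l : List (Σ k, (X k).compl)} (hl : ∀ p ∈ l.getLast?, p.1 ≠ k) :
    rightMap k T (tensorWord X l) = tensorWord X l * embed X k (T (X k).vec) := by
  rcases List.eq_nil_or_concat l with rfl | ⟨l, ⟨j, x⟩, rfl⟩
  · simp [tensorWord, rightMap_one]
  · rw [List.concat_eq_append, tensorWord_concat]
    exact rightMap_letter_ne (hl ⟨j, x⟩ (by simp)) T x _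

theorem leftMap_embed_mul (k : κ) (T : Module.End ℂ (X k).carrier) (y : (X k).carrier)
    {l : List (Σ k, (X k).compl)} (hl : ∀ p ∈ l.head?, p.1 ≠ k) :
    leftMap k T (embed X k y * tensorWord X l) = embed X k (T y) * tensorWord X l := by
  conv_rhs => rw [← (X k).state_smul_vec_add_proj y]
  simp only [embed_apply k y, add_mul, smul_mul_assoc, one_mul, map_add, map_smul,
    leftMap_tensorWord k T hl, leftMap_letter_same]

theorem rightMap_mul_embed (k : κ) (T : Module.End ℂ (X k).carrier) (y : (X k).carrier)
    {l : List (Σ k, (X k).compl)} (hl : ∀ p ∈ l.getLast?, p.1 ≠ k) :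
    rightMap k T (tensorWord X l * embed X k y) = tensorWord X l * embed X k (T y) := by
  conv_rhs => rw [← (X k).state_smul_vec_add_proj y]
  simp only [embed_apply k y, mul_add, mul_smul_comm, mul_one, map_add, map_smul,
    rightMap_tensorWord k T hl, rightMap_letter_same]

theorem eqOn_freeSpace_of_embed_mul (k : κ) {f g : Tensors X →ₗ[ℂ] Tensors X}
    (h : ∀ (y : (X k).carrier) (l : List (Σ k, (X k).compl)), (∀ p ∈ l.head?, p.1 ≠ k) →
      f (embed X k y * tensorWord X l) = g (embed X k y * tensorWord X l)) :
    Set.EqOn f g (freeSpace X) := by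
  refine LinearMap.eqOn_span' ?_
  rintro _ ⟨l, hl, rfl⟩
  rcases l with _ | ⟨⟨j, x⟩, l⟩
  · simpa [embed_vec] using h (X k).vec [] (by simp)
  · rcases eq_or_ne j k with rfl | hjk
    · simpa only [tensorWord_cons, embed_coe] using h x l (Alternating.head?_ne hl)
    · simpa [embed_vec] using h (X k).vec (⟨j, x⟩ :: l) (by simpa using hjk)

theorem eqOn_freeSpace_of_mul_embed (k : κ) {f g : Tensors X →ₗ[ℂ] Tensors X}
    (h : ∀ (y : (X k).carrier) (l : List (Σ k, (X k).compl)), (∀ p ∈ l.getLast?, p.1 ≠ k) →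
      f (tensorWord X l * embed X k y) = g (tensorWord X l * embed X k y)) :
    Set.EqOn f g (freeSpace X) := by
  refine LinearMap.eqOn_span' ?_
  rintro _ ⟨l, hl, rfl⟩
  rcases List.eq_nil_or_concat' l with rfl | ⟨l, ⟨j, x⟩, rfl⟩
  · simpa [embed_vec] using h (X k).vec [] (by simp)
  · rcases eq_or_ne j k with rfl | hjk
    · simpa only [tensorWord_concat, embed_coe] using h x l (Alternating.getLast?_ne hl)
    · simpa [embed_vec] using h (X k).vec (l ++ [⟨j, x⟩]) (by simpa using hjk)

/-- The left representation `leftRep k` as a homomorphism of algebras. -/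
noncomputable def leftRepHom (k : κ) :
    Module.End ℂ (X k).carrier →ₐ[ℂ] Module.End ℂ (freeProduct X).carrier :=
  AlgHom.ofLinearMap
    { toFun := leftRep k
      map_add' := fun S T => LinearMap.ext fun u => Subtype.ext <|
        eqOn_freeSpace_of_embed_mul k (f := leftMap k (S + T)) (g := leftMap k S + leftMap k T)
          (fun y l hl => by simp [leftMap_embed_mul k _ _ hl, add_mul]) u.2
      map_smul' := fun c T => LinearMap.ext fun u => Subtype.ext <|
        eqOn_freeSpace_of_embed_mul k (f := leftMap k (c • T)) (g := c • leftMap k T)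
          (fun y l hl => by simp [leftMap_embed_mul k _ _ hl]) u.2 }
    (LinearMap.ext fun u => Subtype.ext <|
      eqOn_freeSpace_of_embed_mul k (f := leftMap k 1) (g := LinearMap.id)
        (fun y l hl => by simp [leftMap_embed_mul k _ _ hl]) u.2)
    (fun S T => LinearMap.ext fun u => Subtype.ext <|
      eqOn_freeSpace_of_embed_mul k (f := leftMap k (S * T)) (g := leftMap k S ∘ₗ leftMap k T)
        (fun y l hl => by simp [leftMap_embed_mul k _ _ hl]) u.2)

/-- The right representation `rightRep k` as a homomorphism of algebras. -/
noncomputable def rightRepHom (k : κ) :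
    Module.End ℂ (X k).carrier →ₐ[ℂ] Module.End ℂ (freeProduct X).carrier :=
  AlgHom.ofLinearMap
    { toFun := rightRep k
      map_add' := fun S T => LinearMap.ext fun u => Subtype.ext <|
        eqOn_freeSpace_of_mul_embed k (f := rightMap k (S + T)) (g := rightMap k S + rightMap k T)
          (fun y l hl => by simp [rightMap_mul_embed k _ _ hl, mul_add]) u.2
      map_smul' := fun c T => LinearMap.ext fun u => Subtype.ext <|
        eqOn_freeSpace_of_mul_embed k (f := rightMap k (c • T)) (g := c • rightMap k T)
          (fun y l hl => by simp [rightMap_mul_embed k _ _ hl]) u.2 }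
    (LinearMap.ext fun u => Subtype.ext <|
      eqOn_freeSpace_of_mul_embed k (f := rightMap k 1) (g := LinearMap.id)
        (fun y l hl => by simp [rightMap_mul_embed k _ _ hl]) u.2)
    (fun S T => LinearMap.ext fun u => Subtype.ext <|
      eqOn_freeSpace_of_mul_embed k (f := rightMap k (S * T)) (g := rightMap k S ∘ₗ rightMap k T)
        (fun y l hl => by simp [rightMap_mul_embed k _ _ hl]) u.2)

theorem aeval_leftRep (k : κ) (T : Module.End ℂ (X k).carrier) (f : Polynomial ℂ) :
    Polynomial.aeval (leftRep k T) f = leftRep k (Polynomial.aeval T f) :=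
  Polynomial.aeval_algHom_apply (leftRepHom k) T f

theorem aeval_rightRep (k : κ) (T : Module.End ℂ (X k).carrier) (f : Polynomial ℂ) :
    Polynomial.aeval (rightRep k T) f = rightRep k (Polynomial.aeval T f) :=
  Polynomial.aeval_algHom_apply (rightRepHom k) T f

theorem vectorState_leftRep (k : κ) (T : Module.End ℂ (X k).carrier) :
    vectorState (freeProduct X) (leftRep k T) = (X k).state (T (X k).vec) :=
  (congrArg TensorAlgebra.algebraMapInv (leftMap_one k T)).trans (algebraMapInv_embed k _)

theorem vectorState_rightRep (k : κ) (T : Module.End ℂ (X k).carrier) :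
    vectorState (freeProduct X) (rightRep k T) = (X k).state (T (X k).vec) :=
  (congrArg TensorAlgebra.algebraMapInv (rightMap_one k T)).trans (algebraMapInv_embed k _)

theorem coe_leftRep_prod (T : ∀ k, Module.End ℂ (X k).carrier) (l : List κ) (u : freeSpace X) :
    (freeSpace X).subtype ((l.map fun k => leftRep k (T k)).prod u) =
      (l.map fun k => leftMap k (T k)).prod (u : Tensors X) := by
  induction l with
  | nil => rfl
  | cons i l ih => exact congrArg (leftMap i (T i)) ih

theorem coe_rightRep_prod_vec {U : ∀ k, Module.End ℂ (X k).carrier}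
    (hU : ∀ k, (X k).state (U k (X k).vec) = 0) {l : List κ} (hl : l.IsChain (· ≠ ·)) :
    (freeSpace X).subtype ((l.map fun k => rightRep k (U k)).prod (freeProduct X).vec) =
      tensorWord X (l.reverse.map fun k => ⟨k, (X k).proj (U k (X k).vec)⟩) := by
  induction l with
  | nil => rfl
  | cons j l ih =>
    have hne : ∀ p ∈ (l.reverse.map fun k =>
        (⟨k, (X k).proj (U k (X k).vec)⟩ : Σ k, (X k).compl)).getLast?, p.1 ≠ j := by
      intro p hp
      obtain ⟨i, hi, rfl⟩ : ∃ i ∈ l.head?, _ = p := by simpa using hp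
      exact ((List.isChain_cons.1 hl).1 i hi).symm
    refine (congrArg (rightMap j (U j)) (ih hl.tail)).trans ?_
    rw [rightMap_tensorWord j (U j) hne, embed_of_state_eq_zero (hU j), List.reverse_cons,
      List.map_append, List.map_singleton, tensorWord_concat]

theorem algebraMapInv_leftMap_prod {T : ∀ k, Module.End ℂ (X k).carrier}
    (hT : ∀ k, (X k).state (T k (X k).vec) = 0) {l : List κ} (hl : l.IsChain (· ≠ ·))
    (r : List (Σ k, (X k).compl)) :
    TensorAlgebra.algebraMapInv ((l.map fun k => leftMap k (T k)).prod (tensorWord X r)) =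
      if l.reverse = r.map Sigma.fst then (r.map fun p => (X p.1).state (T p.1 p.2)).prod
      else 0 := by
  induction l using List.reverseRecOn generalizing r with
  | nil => rcases r with _ | ⟨p, r⟩ <;> simp [tensorWord, algebraMapInv_letter_mul]
  | append_singleton l i ih =>
    have hl' : l.IsChain (· ≠ ·) := hl.left_of_append
    have map_letter_mul (y : (X i).compl) (r : List (Σ k, (X k).compl)) :
        TensorAlgebra.algebraMapInv
          ((l.map fun k => leftMap k (T k)).prod (letter X i y * tensorWord X r)) = 0 := by
      rw [← tensorWord_cons ⟨i, y⟩ r, ih hl', if_neg]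
      intro h
      have hi : i ∈ l.getLast? := by simp [← List.head?_reverse, h]
      exact (List.isChain_append.1 hl).2.2 i hi i (by simp) rfl
    rw [List.map_append, List.prod_append, List.map_singleton, List.prod_singleton,
      Module.End.mul_apply, List.reverse_append, List.reverse_singleton, List.singleton_append]
    rcases r with _ | ⟨⟨j, y⟩, r⟩
    · simpa [tensorWord, leftMap_one, embed_of_state_eq_zero (hT i)]
        using map_letter_mul ((X i).proj (T i (X i).vec)) []
    · rcases eq_or_ne j i with rfl | hji
      · rw [tensorWord_cons, leftMap_letter_same, embed_apply, add_mul, map_add, map_add,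
          map_letter_mul, add_zero, smul_mul_assoc, one_mul, map_smul, map_smul, ih hl']
        simp
      · rw [leftMap_tensorWord i (T i) (by simpa using hji), embed_of_state_eq_zero (hT i),
          map_letter_mul, if_neg (by simp [hji.symm])]

end FreeProduct

section Moments

variable {κ : Type w}

theorem jointDistribution_aeval {A : Type u} [Ring A] [Algebra ℂ A] (φ : A →ₗ[ℂ] ℂ) (a b : κ → A)
    (f g : κ → Polynomial ℂ) (l r : List κ) :
    jointDistribution φ a b
        ((l.map fun k => Polynomial.aeval (FreeAlgebra.ι ℂ (Sum.inl k)) (f k)).prod *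
          (r.map fun k => Polynomial.aeval (FreeAlgebra.ι ℂ (Sum.inr k)) (g k)).prod) =
      φ ((l.map fun k => Polynomial.aeval (a k) (f k)).prod *
        (r.map fun k => Polynomial.aeval (b k) (g k)).prod) := by
  simp [jointDistribution, map_list_prod, Function.comp_def, ← Polynomial.aeval_algHom_apply]

variable [DecidableEq κ]

/-- Alternating words in the families `α` and `β` are biorthogonal for the bilinear form
`φ (x * y)`: this is how bi-freeness enters the computation of joint moments. -/
def HasDiagonalMoments {A : Type*} [Monoid A] (φ : A → ℂ) (α β : κ → A) : Prop :=
  ∀ ⦃l r : List κ⦄, l.IsChain (· ≠ ·) → r.IsChain (· ≠ ·) →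
    φ ((l.map α).prod * (r.map β).prod) =
      if l = r then (l.map fun k => φ (α k * β k)).prod else 0

theorem HasDiagonalMoments.of_map_eq {A B : Type*} [Monoid A] [Monoid B] {φ : A → ℂ} {ψ : B → ℂ}
    {α β : κ → A} {α' β' : κ → B} (h : HasDiagonalMoments ψ α' β')
    (hψ : ∀ l r : List κ, φ ((l.map α).prod * (r.map β).prod) =
      ψ ((l.map α').prod * (r.map β').prod)) :
    HasDiagonalMoments φ α β := by
  have hpair (k : κ) : φ (α k * β k) = ψ (α' k * β' k) := by simpa using hψ [k] [k]
  intro l r hl hr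
  simp only [hψ, h hl hr, hpair]

theorem hasDiagonalMoments_leftRep_rightRep {X : κ → PointedSpace.{v}}
    {T U : ∀ k, Module.End ℂ (X k).carrier}
    (hT : ∀ k, (X k).state (T k (X k).vec) = 0) (hU : ∀ k, (X k).state (U k (X k).vec) = 0) :
    HasDiagonalMoments (vectorState (freeProduct X)) (fun k => leftRep k (T k))
      (fun k => rightRep k (U k)) := by
  have moment {l r : List κ} (hl : l.IsChain (· ≠ ·)) (hr : r.IsChain (· ≠ ·)) :
      vectorState (freeProduct X) ((l.map fun k => leftRep k (T k)).prod *
          (r.map fun k => rightRep k (U k)).prod) =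
        if l = r then (l.map fun k => (X k).state (T k (U k (X k).vec))).prod else 0 := by
    refine (congrArg TensorAlgebra.algebraMapInv ((coe_leftRep_prod T l _).trans
      (congrArg _ (coe_rightRep_prod_vec hU hr)))).trans ?_
    rw [algebraMapInv_leftMap_prod hT hl, List.map_map, List.map_map]
    simp only [Function.comp_def, List.map_id_fun', id, List.reverse_inj, List.map_reverse,
      List.prod_reverse, PointedSpace.coe_proj_of_state_eq_zero (hU _)]
    split_ifs with h
    · rw [h]
    · rfl
  have pair (k : κ) : vectorState (freeProduct X) (leftRep k (T k) * rightRep k (U k)) =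
      (X k).state (T k (U k (X k).vec)) := by
    simpa using moment (l := [k]) (r := [k]) (by simp) (by simp)
  intro l r hl hr
  simp only [pair, moment hl hr]

theorem IsBiFree.hasDiagonalMoments_aeval {A : Type u} [Ring A] [Algebra ℂ A] {φ : A →ₗ[ℂ] ℂ}
    {a b : κ → A} (h : IsBiFree.{u, v, w} φ a b) {f g : κ → Polynomial ℂ}
    (hf : ∀ k, φ (Polynomial.aeval (a k) (f k)) = 0)
    (hg : ∀ k, φ (Polynomial.aeval (b k) (g k)) = 0) :
    HasDiagonalMoments φ (fun k => Polynomial.aeval (a k) (f k))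
      (fun k => Polynomial.aeval (b k) (g k)) := by
  obtain ⟨X, L, R, hX⟩ := h
  have hmap (l r : List κ) : φ ((l.map fun k => Polynomial.aeval (a k) (f k)).prod *
      (r.map fun k => Polynomial.aeval (b k) (g k)).prod) =
      vectorState (freeProduct X) ((l.map fun k => leftRep k (Polynomial.aeval (L k) (f k))).prod *
        (r.map fun k => rightRep k (Polynomial.aeval (R k) (g k))).prod) := by
    rw [← jointDistribution_aeval, hX, jointDistribution_aeval]
    simp only [aeval_leftRep, aeval_rightRep]
  refine (hasDiagonalMoments_leftRep_rightRep (fun k => ?_) (fun k => ?_)).of_map_eq hmap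
  · simpa [vectorState_leftRep, hf] using (hmap [k] []).symm
  · simpa [vectorState_rightRep, hg] using (hmap [] [k]).symm

end Moments

section ClosedAlgebras

theorem isClosed_setOf_hasDiagonalMoments {κ : Type*} [DecidableEq κ] {A : Type*} [Monoid A]
    [TopologicalSpace A] [ContinuousMul A] {φ : A → ℂ} (hφ : Continuous φ) :
    IsClosed {p : (κ → A) × (κ → A) | HasDiagonalMoments φ p.1 p.2} := by
  simp only [HasDiagonalMoments, Set.ofPred_forall]
  refine isClosed_iInter fun l => isClosed_iInter fun r => isClosed_iInter fun _ =>
    isClosed_iInter fun _ => isClosed_eq ?_ ?_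
  · exact hφ.comp (.mul (continuous_list_prod _ fun k _ => by fun_prop)
      (continuous_list_prod _ fun k _ => by fun_prop))
  · split_ifs
    · exact continuous_list_prod _ fun k _ => by fun_prop
    · exact continuous_const

theorem mem_closure_inter_ker {A : Type*} [Ring A] [Algebra ℂ A] [TopologicalSpace A]
    [IsTopologicalRing A] [ContinuousSMul ℂ A] {φ : A →L[ℂ] ℂ} (hφ : φ 1 = 1)
    {S : Subalgebra ℂ A} {x : A} (hx : x ∈ S.topologicalClosure) (hx0 : φ x = 0) :
    x ∈ closure {y | y ∈ S ∧ φ y = 0} := by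
  have hcont : Continuous fun y : A => y - φ y • (1 : A) := by fun_prop
  have hmaps : Set.MapsTo (fun y : A => y - φ y • (1 : A)) S {y | y ∈ S ∧ φ y = 0} :=
    fun y hy => ⟨S.sub_mem hy (S.smul_mem S.one_mem _), by simp [hφ]⟩
  simpa [hx0] using map_mem_closure hcont hx hmaps

variable {A : Type u} [NormedRing A] [NormedAlgebra ℂ A]

/-- The elements of the closed unital algebra generated by `a` on which `φ` vanishes. -/
noncomputable def centred (φ : A →L[ℂ] ℂ) (a : A) : Submodule ℂ A :=
  (Algebra.elemental ℂ a).toSubmodule ⊓ LinearMap.ker (φ : A →ₗ[ℂ] ℂ)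

theorem mem_centred {φ : A →L[ℂ] ℂ} {a x : A} :
    x ∈ centred φ a ↔ x ∈ Algebra.elemental ℂ a ∧ φ x = 0 := Iff.rfl

theorem IsBiFree.hasDiagonalMoments {κ : Type w} [DecidableEq κ] {φ : A →L[ℂ] ℂ} (hφ : φ 1 = 1)
    {a b : κ → A} (h : IsBiFree.{u, v, w} (φ : A →ₗ[ℂ] ℂ) a b) {α β : κ → A}
    (hα : ∀ k, α k ∈ centred φ (a k)) (hβ : ∀ k, β k ∈ centred φ (b k)) :
    HasDiagonalMoments φ α β := by
  let S (c : κ → A) : Set (κ → A) :=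
    Set.univ.pi fun k => {y | y ∈ Algebra.adjoin ℂ {c k} ∧ φ y = 0}
  have hclosure {c γ : κ → A} (hγ : ∀ k, γ k ∈ centred φ (c k)) : γ ∈ closure (S c) := by
    rw [closure_pi_set]
    exact fun k _ => mem_closure_inter_ker hφ (mem_centred.1 (hγ k)).1 (mem_centred.1 (hγ k)).2
  have hpoly : S a ×ˢ S b ⊆ {p : (κ → A) × (κ → A) | HasDiagonalMoments φ p.1 p.2} := by
    rintro ⟨x, y⟩ ⟨hx, hy⟩
    choose hxa hx0 using fun k => hx k (Set.mem_univ k)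
    choose hyb hy0 using fun k => hy k (Set.mem_univ k)
    simp only [Algebra.adjoin_singleton_eq_range_aeval, AlgHom.mem_range] at hxa hyb
    choose f hf using hxa
    choose g hg using hyb
    obtain rfl : (fun k => Polynomial.aeval (a k) (f k)) = x := funext hf
    obtain rfl : (fun k => Polynomial.aeval (b k) (g k)) = y := funext hg
    exact h.hasDiagonalMoments_aeval hx0 hy0
  have hmem : (α, β) ∈ closure (S a ×ˢ S b) := by
    rw [closure_prod_eq]
    exact ⟨hclosure hα, hclosure hβ⟩
  exact closure_minimal hpoly (isClosed_setOf_hasDiagonalMoments φ.continuous) hmem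

theorem IsBiFree.map_mul_right {κ : Type w} [DecidableEq κ] {φ : A →L[ℂ] ℂ} (hφ : φ 1 = 1)
    {a b : κ → A} (h : IsBiFree.{u, v, w} (φ : A →ₗ[ℂ] ℂ) a b) {i j : κ} (hij : i ≠ j) :
    φ (b i * b j) = φ (b i) * φ (b j) := by
  have hmem (k : κ) : b k - φ (b k) • (1 : A) ∈ centred φ (b k) :=
    mem_centred.2 ⟨sub_mem (Algebra.elemental.self_mem ℂ _) (Subalgebra.smul_mem _ (one_mem _) _),
      by simp [hφ]⟩
  have hword := h.hasDiagonalMoments hφ (α := 0) (fun k => zero_mem _) hmem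
    (l := []) (r := [i, j]) (by simp) (by simpa using hij)
  simp only [List.map_nil, List.prod_nil, List.map_cons, List.prod_cons, mul_one, mul_sub, sub_mul,
    Algebra.smul_mul_assoc, one_mul, Algebra.mul_smul_comm, map_sub, map_smul, smul_eq_mul, hφ,
    sub_self, mul_zero, sub_zero, List.nil_eq, reduceCtorEq, ↓reduceIte] at hword
  linear_combination hword

end ClosedAlgebras

section AlternatingSeries

/-- The alternating words in two letters, parametrised: the word `0101⋯01` of length `2 * n`,
preceded by a letter `1` if `p` holds and followed by a letter `0` if `q` holds. -/
def altWord (n : ℕ) (p q : Bool) : List (Fin 2) :=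
  cond p [1] [] ++ (List.replicate n [0, 1]).flatten ++ cond q [0] []

theorem isChain_altWord (n : ℕ) (p q : Bool) : (altWord n p q).IsChain (· ≠ ·) := by
  induction n generalizing p with
  | zero => cases p <;> cases q <;> simp [altWord]
  | succ n ih =>
    have htail : (altWord n true q).IsChain (· ≠ ·) := ih true
    cases p <;> simpa [altWord, List.replicate_succ] using htail

theorem altWord_inj {m n : ℕ} {p q p' q' : Bool} :
    altWord m p q = altWord n p' q' ↔ m = n ∧ p = p' ∧ q = q' := by
  refine ⟨fun h => ?_, by rintro ⟨rfl, rfl, rfl⟩; rfl⟩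
  have head (n : ℕ) (p q : Bool) : (altWord n p q).head? = some 1 ↔ p = true := by
    cases p <;> cases q <;> cases n <;> simp [altWord, List.replicate_succ]
  have count_one (n : ℕ) (p q : Bool) : (altWord n p q).count 1 = n + p.toNat := by
    cases p <;> cases q <;> simp [altWord, List.count_flatten]
  have count_zero (n : ℕ) (p q : Bool) : (altWord n p q).count 0 = n + q.toNat := by
    cases p <;> cases q <;> simp [altWord, List.count_flatten]
  obtain rfl : p = p' := Bool.eq_iff_iff.2 (by rw [← head m p q, h, head])
  obtain rfl : m = n := by simpa [count_one] using congrArg (List.count 1) h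
  have hq : q.toNat = q'.toNat := by simpa [count_zero] using congrArg (List.count 0) h
  exact ⟨rfl, rfl, by cases q <;> cases q' <;> simp at hq ⊢⟩

theorem prod_map_altWord {M : Type*} [Monoid M] (x : Fin 2 → M) (n : ℕ) (p q : Bool) :
    ((altWord n p q).map x).prod = cond p (x 1) 1 * (x 0 * x 1) ^ n * cond q (x 0) 1 := by
  cases p <;> cases q <;> simp [altWord, List.prod_flatten, mul_assoc]

section Algebra

variable {R : Type*} [Ring R] [Algebra ℂ R]

/-- The part of degree `n` in `c` of the alternating series `altSeries c x`. -/
def altTerm (c : ℂ) (x : Fin 2 → R) (n : ℕ) : R :=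
  (1 + x 1) * (c • (x 0 * x 1)) ^ n * (1 + x 0)

/-- The sum of all alternating products in `x 0` and `x 1`, where a word is weighted by `c ^ n` if
`x 0 * x 1` occurs `n` times in it. The value is meaningful if `1 - c • (x 0 * x 1)` is
invertible. -/
noncomputable def altSeries (c : ℂ) (x : Fin 2 → R) : R :=
  (1 + x 1) * Ring.inverse (1 - c • (x 0 * x 1)) * (1 + x 0)

theorem altTerm_eq_sum (c : ℂ) (x : Fin 2 → R) (n : ℕ) :
    altTerm c x n = c ^ n • ∑ p : Bool × Bool, ((altWord n p.1 p.2).map x).prod := by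
  simp only [prod_map_altWord, Fintype.sum_prod_type, Fintype.sum_bool, cond_true, cond_false,
    altTerm, smul_pow, mul_smul_comm, smul_mul_assoc]
  noncomm_ring

theorem HasDiagonalMoments.map_altTerm_mul_altTerm {φ : R →ₗ[ℂ] ℂ} {α β : Fin 2 → R}
    (h : HasDiagonalMoments φ α β) (c : ℂ) (m n : ℕ) :
    φ (altTerm 1 α m * altTerm c β n) =
      if m = n then altTerm c (fun k => φ (α k * β k)) n else 0 := by
  simp only [altTerm_eq_sum, one_pow, one_smul, mul_smul_comm, Finset.sum_mul_sum, map_smul,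
    map_sum, h (isChain_altWord _ _ _) (isChain_altWord _ _ _), altWord_inj, ← Prod.ext_iff]
  split_ifs with hmn
  · subst hmn
    simp
  · simp [hmn]

end Algebra

section Analysis

variable {R : Type*} [NormedRing R] [NormedAlgebra ℂ R] [CompleteSpace R]

theorem hasSum_altTerm {c : ℂ} {x : Fin 2 → R} (h : ‖c • (x 0 * x 1)‖ < 1) :
    HasSum (altTerm c x) (altSeries c x) :=
  ((hasSum_geom_series_inverse _ h).mul_left _).mul_right _

theorem HasDiagonalMoments.map_altSeries_mul_altSeries {φ : R →L[ℂ] ℂ} {α β : Fin 2 → R}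
    (h : HasDiagonalMoments φ α β) {c : ℂ} (hα : ‖α 0 * α 1‖ < 1) (hβ : ‖c • (β 0 * β 1)‖ < 1)
    (hαβ : ‖c • (φ (α 0 * β 0) * φ (α 1 * β 1))‖ < 1) :
    φ (altSeries 1 α * altSeries c β) = altSeries c fun k => φ (α k * β k) := by
  have hterm (m n : ℕ) : φ (altTerm 1 α m * altTerm c β n) =
      if m = n then altTerm c (fun k => φ (α k * β k)) n else 0 :=
    HasDiagonalMoments.map_altTerm_mul_altTerm (φ := (φ : R →ₗ[ℂ] ℂ)) h c m n
  have hrow (m : ℕ) : φ (altTerm 1 α m * altSeries c β) =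
      altTerm c (fun k => φ (α k * β k)) m := by
    have hsum := ((hasSum_altTerm hβ).mul_left (altTerm 1 α m)).mapL φ
    have hdiag := hasSum_single (f := fun n => φ (altTerm 1 α m * altTerm c β n)) m
      fun n hn => by rw [hterm, if_neg hn.symm]
    rw [hterm, if_pos rfl] at hdiag
    exact hsum.unique hdiag
  have hsum := ((hasSum_altTerm (c := 1) (by simpa using hα)).mul_right (altSeries c β)).mapL φ
  simp only [hrow] at hsum
  exact hsum.unique (hasSum_altTerm hαβ)

end Analysis

end AlternatingSeries

section Resolvents

theorem ringInverse_smul {𝕜 R : Type*} [Field 𝕜] [Ring R] [Algebra 𝕜 R] {c : 𝕜} (hc : c ≠ 0)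
    (x : R) : Ring.inverse (c • x) = c⁻¹ • Ring.inverse x := by
  have hunit : IsUnit (algebraMap 𝕜 R c) := (IsUnit.mk0 c hc).map (algebraMap 𝕜 R)
  have hinv : Ring.inverse (algebraMap 𝕜 R c) = algebraMap 𝕜 R c⁻¹ :=
    Ring.inverse_unit ((Units.mk0 c hc).map (algebraMap 𝕜 R).toMonoidHom)
  rw [Algebra.smul_def, Ring.inverse_mul (Or.inl hunit), hinv, Algebra.smul_def,
    Algebra.commutes]

theorem ringInverse_eq_smul_altSeries {R : Type*} [Ring R] [Algebra ℂ R] {v : ℂ} (hv : v ≠ 0)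
    {y β : Fin 2 → R} (hy : ∀ k, IsUnit (y k))
    (hinv : ∀ k, Ring.inverse (y k) = v • (1 + β k)) (c : ℂ) :
    Ring.inverse ((v * (1 - c)) • (y 0 * y 1) + c • (y 0 + y 1) - (c * v⁻¹) • (1 : R)) =
      v • altSeries c β := by
  have h0 : y 0 * β 0 = v⁻¹ • 1 - y 0 := by
    rw [eq_sub_iff_add_eq', ← mul_one_add, eq_inv_smul_iff₀ hv, ← mul_smul_comm, ← hinv,
      Ring.mul_inverse_cancel _ (hy 0)]
  have h1 : β 1 * y 1 = v⁻¹ • 1 - y 1 := by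
    rw [eq_sub_iff_add_eq', ← one_add_mul, eq_inv_smul_iff₀ hv, ← smul_mul_assoc, ← hinv,
      Ring.inverse_mul_cancel _ (hy 1)]
  have factor : (v * (1 - c)) • (y 0 * y 1) + c • (y 0 + y 1) - (c * v⁻¹) • (1 : R) =
      v • (y 0 * (1 - c • (β 0 * β 1)) * y 1) := by
    calc _ = v • (y 0 * y 1 - c • ((v⁻¹ • 1 - y 0) * (v⁻¹ • 1 - y 1))) := by
          simp only [mul_sub, sub_mul, smul_mul_assoc, mul_smul_comm, one_mul, mul_one]
          match_scalars <;> field_simp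
      _ = v • (y 0 * (1 - c • (β 0 * β 1)) * y 1) := by
          rw [← h0, ← h1, mul_sub, sub_mul, mul_one, mul_smul_comm, smul_mul_assoc]
          simp only [mul_assoc]
  rw [factor, ringInverse_smul hv, Ring.inverse_mul (Or.inr (hy 1)),
    Ring.inverse_mul (Or.inl (hy 0)), hinv, hinv, mul_smul_comm, mul_smul_comm, smul_mul_assoc,
    inv_smul_smul₀ hv, ← mul_assoc, altSeries]

variable {A : Type u} [NormedRing A] [NormedAlgebra ℂ A] {φ : A →L[ℂ] ℂ} {a b : A} {s t : ℂ}

/-- The element `x°` with `(1 - sa)⁻¹ = φ((1 - sa)⁻¹) • (1 + x°)`. As `(t1 - a)⁻¹` is a multiple of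
`(1 - t⁻¹a)⁻¹`, the same notion with `s = t⁻¹` serves the left variables. -/
noncomputable def deviation (φ : A →L[ℂ] ℂ) (a : A) (s : ℂ) : A :=
  (φ (Ring.inverse (1 - s • a)))⁻¹ • Ring.inverse (1 - s • a) - 1

/-- The resolvent `(1 - sa)⁻¹` exists, lies in the closed algebra generated by `a` and can be
normalised by `φ`. -/
structure IsRegular (φ : A →L[ℂ] ℂ) (a : A) (s : ℂ) : Prop where
  isUnit : IsUnit (1 - s • a)
  mem_elemental : Ring.inverse (1 - s • a) ∈ Algebra.elemental ℂ a
  map_ne_zero : φ (Ring.inverse (1 - s • a)) ≠ 0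

/-- The correlation of the normalised resolvents of `a` and `b`, for which
`F_{a,b}(t, s) = G_a(t) (1 + ψ_b(s)) (1 + deviationMoment φ a b t s)`. -/
noncomputable def deviationMoment (φ : A →L[ℂ] ℂ) (a b : A) (t s : ℂ) : ℂ :=
  φ (deviation φ a t⁻¹ * deviation φ b s)

theorem one_add_psi : 1 + psi φ b s = φ (Ring.inverse (1 - s • b)) := by simp [psi]

theorem ringInverse_smul_one_sub (ht : t ≠ 0) :
    Ring.inverse (t • (1 : A) - a) = t⁻¹ • Ring.inverse (1 - t⁻¹ • a) := by
  rw [← ringInverse_smul ht, smul_sub, smul_inv_smul₀ ht]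

theorem cauchyG_eq (ht : t ≠ 0) : cauchyG φ a t = t⁻¹ * φ (Ring.inverse (1 - t⁻¹ • a)) := by
  rw [cauchyG, ringInverse_smul_one_sub ht, map_smul, smul_eq_mul]

namespace IsRegular

theorem deviation_mem_centred (h : IsRegular φ a s) (hφ : φ 1 = 1) :
    deviation φ a s ∈ centred φ a :=
  mem_centred.2 ⟨sub_mem (Subalgebra.smul_mem _ h.mem_elemental _) (one_mem _),
    by simp [deviation, hφ, h.map_ne_zero]⟩

theorem ringInverse_one_sub (h : IsRegular φ b s) :
    Ring.inverse (1 - s • b) = (1 + psi φ b s) • (1 + deviation φ b s) := by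
  rw [one_add_psi, deviation, add_sub_cancel, smul_inv_smul₀ h.map_ne_zero]

theorem ringInverse_sub (h : IsRegular φ a t⁻¹) (ht : t ≠ 0) :
    Ring.inverse (t • (1 : A) - a) = cauchyG φ a t • (1 + deviation φ a t⁻¹) := by
  rw [ringInverse_smul_one_sub ht, h.ringInverse_one_sub, one_add_psi, cauchyG_eq ht, mul_smul]

theorem isUnit_sub (h : IsRegular φ a t⁻¹) (ht : t ≠ 0) : IsUnit (t • (1 : A) - a) := by
  have hfactor : t • (1 : A) - a = Units.mk0 t ht • (1 - t⁻¹ • a) := by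
    rw [Units.smul_mk0, smul_sub, smul_inv_smul₀ ht]
  rw [hfactor]
  exact h.isUnit.smul _

theorem mixedF_eq (ha : IsRegular φ a t⁻¹) (hb : IsRegular φ b s) (hφ : φ 1 = 1) (ht : t ≠ 0) :
    mixedF φ a b t s =
      cauchyG φ a t * (1 + psi φ b s) * (1 + deviationMoment φ a b t s) := by
  have hα := (mem_centred.1 (ha.deviation_mem_centred hφ)).2
  have hβ := (mem_centred.1 (hb.deviation_mem_centred hφ)).2
  rw [mixedF, ha.ringInverse_sub ht, hb.ringInverse_one_sub, deviationMoment]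
  simp only [smul_mul_smul_comm, map_smul, smul_eq_mul, one_add_mul, mul_one_add, map_add, hφ, hα,
    hβ]
  ring

end IsRegular

theorem ringInverse_sub_add {a : Fin 2 → A} {t : Fin 2 → ℂ} {z : ℂ} (hz : z ≠ 0)
    (ha : ∀ k, IsRegular φ (a k) (t k)⁻¹) (ht : ∀ k, t k ≠ 0)
    (hG : ∀ k, cauchyG φ (a k) (t k) = z) :
    Ring.inverse ((t 0 + t 1 - z⁻¹) • (1 : A) - (a 0 + a 1)) =
      z • altSeries 1 fun k => deviation φ (a k) (t k)⁻¹ := by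
  rw [← ringInverse_eq_smul_altSeries hz (fun k => (ha k).isUnit_sub (ht k))
    (fun k => by rw [(ha k).ringInverse_sub (ht k), hG k])]
  congr 1
  module

theorem ringInverse_one_sub_mul {b : Fin 2 → A} {s : Fin 2 → ℂ} {w : ℂ} (hw : w ≠ 0)
    (hw1 : 1 + w ≠ 0) (hb : ∀ k, IsRegular φ (b k) (s k)) (hψ : ∀ k, psi φ (b k) (s k) = w) :
    Ring.inverse (1 - (s 0 * s 1 * ((1 + w) / w)) • (b 0 * b 1)) =
      (1 + w) • altSeries ((1 + w) / w) fun k => deviation φ (b k) (s k) := by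
  rw [← ringInverse_eq_smul_altSeries hw1 (fun k => (hb k).isUnit)
    (fun k => by rw [(hb k).ringInverse_one_sub, hψ k])]
  congr 1
  simp only [mul_sub, sub_mul, one_mul, mul_one, mul_smul_comm, smul_mul_assoc]
  match_scalars <;> field_simp <;> ring

end Resolvents

section Germs

theorem eventuallyEq_of_hasStrictDerivAt {𝕜 ι : Type*} [NontriviallyNormedField 𝕜]
    [CompleteSpace 𝕜] {l : Filter ι} {f : 𝕜 → 𝕜} {f' x : 𝕜} (hf : HasStrictDerivAt f f' x)
    (hf' : f' ≠ 0) {p q : ι → 𝕜} (hp : Tendsto p l (𝓝 x)) (hq : Tendsto q l (𝓝 x))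
    (h : ∀ᶠ i in l, f (p i) = f (q i)) : p =ᶠ[l] q := by
  have hinj := (hf.hasStrictFDerivAt_equiv hf').eventually_left_inverse
  filter_upwards [hp.eventually hinj, hq.eventually hinj, h] with i hpi hqi hpq
  rw [← hpi, ← hqi, hpq]

theorem eventually_norm_lt_one {ι E : Type*} [SeminormedAddGroup E] {l : Filter ι} {f : ι → E}
    (hf : Tendsto f l (𝓝 0)) : ∀ᶠ i in l, ‖f i‖ < 1 :=
  hf.norm.eventually_lt_const (by simp)

variable {A : Type u} [NormedRing A] [NormedAlgebra ℂ A] {φ : A →L[ℂ] ℂ} {a b : A} {K χ : ℂ → ℂ}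

theorem IsInverseG.tendsto_inv (hK : IsInverseG φ a K) :
    Tendsto (fun z => (K z)⁻¹) (𝓝[≠] 0) (𝓝 0) :=
  tendsto_inv₀_cobounded.comp hK.1

theorem IsInverseG.eventually_ne_zero (hK : IsInverseG φ a K) : ∀ᶠ z in 𝓝[≠] 0, K z ≠ 0 :=
  hK.1.eventually_ne_cobounded 0

theorem IsInversePsi.tendsto_punctured (hχ : IsInversePsi φ b χ) : Tendsto χ (𝓝[≠] 0) (𝓝 0) :=
  hχ.1.mono_left nhdsWithin_le_nhds

theorem IsInversePsi.eventually_psi_eq (hχ : IsInversePsi φ b χ) :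
    ∀ᶠ w in 𝓝[≠] 0, psi φ b (χ w) = w :=
  hχ.2.filter_mono nhdsWithin_le_nhds

variable [CompleteSpace A]

theorem hasStrictDerivAt_psi (φ : A →L[ℂ] ℂ) (b : A) : HasStrictDerivAt (psi φ b) (φ b) 0 :=
  (hasStrictDerivAt_h φ b).sub_const 1

theorem tendsto_ringInverse_one_sub (a : A) :
    Tendsto (fun s : ℂ => Ring.inverse (1 - s • a)) (𝓝 0) (𝓝 1) := by
  have hlin : Tendsto (fun s : ℂ => 1 - s • a) (𝓝 0) (𝓝 ((1 : Aˣ) : A)) :=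
    Continuous.tendsto' (by fun_prop) _ _ (by simp)
  simpa [Function.comp_def] using (NormedRing.inverse_continuousAt (1 : Aˣ)).tendsto.comp hlin

theorem tendsto_map_ringInverse_one_sub (hφ : φ 1 = 1) (a : A) :
    Tendsto (fun s : ℂ => φ (Ring.inverse (1 - s • a))) (𝓝 0) (𝓝 1) :=
  hφ ▸ (φ.continuous.tendsto 1).comp (tendsto_ringInverse_one_sub a)

theorem tendsto_deviation (hφ : φ 1 = 1) (a : A) : Tendsto (deviation φ a) (𝓝 0) (𝓝 0) := by
  change Tendsto (fun s => deviation φ a s) _ _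
  simpa [deviation] using (((tendsto_map_ringInverse_one_sub hφ a).inv₀ one_ne_zero).smul
    (tendsto_ringInverse_one_sub a)).sub_const 1

theorem ringInverse_one_sub_mem_elemental {x : A} (hx : x ∈ Algebra.elemental ℂ a)
    (hx1 : ‖x‖ < 1) : Ring.inverse (1 - x) ∈ Algebra.elemental ℂ a :=
  (Algebra.elemental.isClosed ℂ a).mem_of_tendsto (hasSum_geom_series_inverse x hx1)
    (Eventually.of_forall fun _ => sum_mem fun n _ => pow_mem hx n)

theorem eventually_isRegular (hφ : φ 1 = 1) (a : A) : ∀ᶠ s in 𝓝 0, IsRegular φ a s := by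
  have hsmall : ∀ᶠ s : ℂ in 𝓝 0, ‖s • a‖ < 1 :=
    (Continuous.tendsto' (by fun_prop) 0 0 (by simp)).eventually_lt_const one_pos
  filter_upwards [hsmall, (tendsto_map_ringInverse_one_sub hφ a).eventually_ne one_ne_zero]
    with s hs hne
  exact ⟨isUnit_one_sub_of_norm_lt_one hs, ringInverse_one_sub_mem_elemental
    (Subalgebra.smul_mem _ (Algebra.elemental.self_mem ℂ a) s) hs, hne⟩

namespace IsInverseG

theorem tendsto_mul (hφ : φ 1 = 1) (hK : IsInverseG φ a K) :
    Tendsto (fun z => z * K z) (𝓝[≠] 0) (𝓝 1) := by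
  refine ((tendsto_map_ringInverse_one_sub hφ a).comp hK.tendsto_inv).congr' ?_
  filter_upwards [hK.2, hK.eventually_ne_zero] with z hz hKz
  rw [cauchyG_eq hKz, inv_mul_eq_iff_eq_mul₀ hKz] at hz
  rw [Function.comp_apply, hz, mul_comm]

theorem eventuallyEq (hφ : φ 1 = 1) {K' : ℂ → ℂ} (hK : IsInverseG φ a K)
    (hK' : IsInverseG φ a K') : K =ᶠ[𝓝[≠] 0] K' := by
  have hderiv : HasStrictDerivAt (fun s : ℂ => s * φ (Ring.inverse (1 - s • a))) 1 0 := by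
    simpa [hφ] using (hasStrictDerivAt_id (0 : ℂ)).fun_mul (hasStrictDerivAt_h φ a)
  have hinv := eventuallyEq_of_hasStrictDerivAt hderiv one_ne_zero hK.tendsto_inv hK'.tendsto_inv
    (by filter_upwards [hK.2, hK'.2, hK.eventually_ne_zero, hK'.eventually_ne_zero]
          with z hz hz' hKz hKz'
        rw [← cauchyG_eq hKz, ← cauchyG_eq hKz', hz, hz'])
  filter_upwards [hinv] with z hz using inv_injective hz

theorem eventually_isRegular (hφ : φ 1 = 1) (hK : IsInverseG φ a K) :
    ∀ᶠ z in 𝓝[≠] 0, IsRegular φ a (K z)⁻¹ :=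
  hK.tendsto_inv.eventually (BiFree.eventually_isRegular hφ a)

theorem tendsto_deviation (hφ : φ 1 = 1) (hK : IsInverseG φ a K) :
    Tendsto (fun z => deviation φ a (K z)⁻¹) (𝓝[≠] 0) (𝓝 0) :=
  (BiFree.tendsto_deviation hφ a).comp hK.tendsto_inv

end IsInverseG

namespace IsInversePsi

theorem eventuallyEq (hb : φ b ≠ 0) (hχ : IsInversePsi φ b χ) {s : ℂ → ℂ}
    (hs : Tendsto s (𝓝[≠] 0) (𝓝 0)) (hs' : ∀ᶠ w in 𝓝[≠] 0, psi φ b (s w) = w) :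
    χ =ᶠ[𝓝[≠] 0] s := by
  refine eventuallyEq_of_hasStrictDerivAt (hasStrictDerivAt_psi φ b) hb hχ.tendsto_punctured hs ?_
  filter_upwards [hχ.eventually_psi_eq, hs'] with w hw hw'
  rw [hw, hw']

theorem eventually_isRegular (hφ : φ 1 = 1) (hχ : IsInversePsi φ b χ) :
    ∀ᶠ w in 𝓝[≠] 0, IsRegular φ b (χ w) :=
  hχ.tendsto_punctured.eventually (BiFree.eventually_isRegular hφ b)

theorem tendsto_deviation (hφ : φ 1 = 1) (hχ : IsInversePsi φ b χ) :
    Tendsto (fun w => deviation φ b (χ w)) (𝓝[≠] 0) (𝓝 0) :=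
  (BiFree.tendsto_deviation hφ b).comp hχ.tendsto_punctured

theorem tendsto_mul_ringInverse (hχ : IsInversePsi φ b χ) :
    Tendsto (fun w => b * Ring.inverse (1 - χ w • b)) (𝓝[≠] 0) (𝓝 b) := by
  simpa using ((tendsto_ringInverse_one_sub b).comp hχ.tendsto_punctured).const_mul b

theorem tendsto_div (hφ : φ 1 = 1) (hb : φ b ≠ 0) (hχ : IsInversePsi φ b χ) :
    Tendsto (fun w => χ w / w) (𝓝[≠] 0) (𝓝 (φ b)⁻¹) := by
  have hψ0 : psi φ b 0 = 0 := by simp [psi, hφ]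
  have hne : ∀ᶠ w in 𝓝[≠] 0, χ w ≠ 0 := by
    filter_upwards [hχ.eventually_psi_eq, self_mem_nhdsWithin] with w hw hw0 hχw
    exact hw0 (by rw [← hw, hχw, hψ0]; rfl)
  have hslope := (hasDerivAt_iff_tendsto_slope.1 (hasStrictDerivAt_psi φ b).hasDerivAt).comp
    (tendsto_nhdsWithin_iff.2 ⟨hχ.tendsto_punctured, hne⟩)
  refine (hslope.inv₀ hb).congr' ?_
  filter_upwards [hχ.eventually_psi_eq] with w hw
  simp only [Function.comp_apply, slope_def_field, hw, hψ0, sub_zero, inv_div]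

theorem tendsto_smul_deviation (hφ : φ 1 = 1) (hb : φ b ≠ 0) (hχ : IsInversePsi φ b χ) :
    Tendsto (fun w => ((1 + w) / w) • deviation φ b (χ w)) (𝓝[≠] 0) (𝓝 ((φ b)⁻¹ • b - 1)) := by
  refine (((hχ.tendsto_div hφ hb).smul hχ.tendsto_mul_ringInverse).sub_const 1).congr' ?_
  filter_upwards [hχ.eventually_psi_eq, hχ.eventually_isRegular hφ, self_mem_nhdsWithin]
    with w hw hreg (hw0 : w ≠ 0)
  have hmap : φ (Ring.inverse (1 - χ w • b)) = 1 + w := by rw [← one_add_psi, hw]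
  have hw1 : 1 + w ≠ 0 := hmap ▸ hreg.map_ne_zero
  have hinv : Ring.inverse (1 - χ w • b) = 1 + χ w • (b * Ring.inverse (1 - χ w • b)) := by
    rw [← sub_eq_iff_eq_add, ← smul_mul_assoc, ← one_sub_mul,
      Ring.mul_inverse_cancel _ hreg.isUnit]
  rw [deviation, hmap]
  nth_rw 2 [hinv]
  match_scalars <;> field_simp
  ring

end IsInversePsi

end Germs

section SumsAndProducts

theorem altSeries_zero {R : Type*} [Ring R] [Algebra ℂ R] (c : ℂ) :
    altSeries c (fun _ => (0 : R)) = 1 := by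
  simp [altSeries]

variable {A : Type u} [NormedRing A] [NormedAlgebra ℂ A] [CompleteSpace A] {φ : A →L[ℂ] ℂ}
  {a b : Fin 2 → A} {K χ : Fin 2 → ℂ → ℂ}

theorem tendsto_left_deviation_mul (hφ : φ 1 = 1) (hK : ∀ k, IsInverseG φ (a k) (K k)) :
    Tendsto (fun z => deviation φ (a 0) (K 0 z)⁻¹ * deviation φ (a 1) (K 1 z)⁻¹)
      (𝓝[≠] 0) (𝓝 0) := by
  simpa using ((hK 0).tendsto_deviation hφ).mul ((hK 1).tendsto_deviation hφ)

theorem tendsto_smul_right_deviation_mul (hφ : φ 1 = 1) (hb : ∀ k, φ (b k) ≠ 0)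
    (hχ : ∀ k, IsInversePsi φ (b k) (χ k)) :
    Tendsto (fun w => ((1 + w) / w) • (deviation φ (b 0) (χ 0 w) * deviation φ (b 1) (χ 1 w)))
      (𝓝[≠] 0) (𝓝 0) := by
  simpa using ((hχ 0).tendsto_smul_deviation hφ (hb 0)).mul ((hχ 1).tendsto_deviation hφ)

theorem IsBiFree.isInverseG_add (hφ : φ 1 = 1)
    (h : IsBiFree.{u, v, 0} (φ : A →ₗ[ℂ] ℂ) a b) (hK : ∀ k, IsInverseG φ (a k) (K k)) :
    IsInverseG φ (a 0 + a 1) fun z => K 0 z + K 1 z - z⁻¹ := by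
  constructor
  · have hmul : Tendsto (fun z => z * (K 0 z + K 1 z - z⁻¹)) (𝓝[≠] 0) (𝓝 1) := by
      refine Tendsto.congr' (f₁ := fun z => z * K 0 z + z * K 1 z - 1) ?_ ?_
      · filter_upwards [self_mem_nhdsWithin] with z (hz : z ≠ 0)
        field_simp
      · simpa using (((hK 0).tendsto_mul hφ).add ((hK 1).tendsto_mul hφ)).sub_const 1
    have hinv : Tendsto (fun z => (K 0 z + K 1 z - z⁻¹)⁻¹) (𝓝[≠] 0) (𝓝[≠] 0) := by
      refine tendsto_nhdsWithin_iff.2 ⟨?_, ?_⟩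
      · have hid : Tendsto (fun z : ℂ => z) (𝓝[≠] 0) (𝓝 0) := nhdsWithin_le_nhds
        have hprod := hid.mul (hmul.inv₀ one_ne_zero)
        rw [zero_mul] at hprod
        refine hprod.congr' ?_
        filter_upwards [self_mem_nhdsWithin] with z (hz : z ≠ 0)
        rw [mul_inv, mul_inv_cancel_left₀ hz]
      · filter_upwards [hmul.eventually_ne one_ne_zero] with z hz
        exact inv_ne_zero (right_ne_zero_of_mul hz)
    simpa [Function.comp_def] using tendsto_inv₀_nhdsNE_zero.comp hinv
  · filter_upwards [eventually_all.2 fun k => (hK k).2,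
      eventually_all.2 fun k => (hK k).eventually_ne_zero,
      eventually_all.2 fun k => (hK k).eventually_isRegular hφ,
      eventually_norm_lt_one (tendsto_left_deviation_mul hφ hK), self_mem_nhdsWithin]
      with z hG hK0 hreg hsmall (hz : z ≠ 0)
    have hα := (h.hasDiagonalMoments hφ (fun k => (hreg k).deviation_mem_centred hφ)
      (β := fun _ => 0) fun k => zero_mem _).map_altSeries_mul_altSeries (c := 1) hsmall
      (by simp) (by simp)
    simp only [altSeries_zero, mul_one, mul_zero, map_zero] at hα
    rw [cauchyG, ringInverse_sub_add hz hreg hK0 hG, map_smul, hα, smul_eq_mul, mul_one]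

theorem tendsto_inversePsi_mul (hφ : φ 1 = 1) (hb : ∀ k, φ (b k) ≠ 0)
    (hχ : ∀ k, IsInversePsi φ (b k) (χ k)) :
    Tendsto (fun w => χ 0 w * χ 1 w * ((1 + w) / w)) (𝓝[≠] 0) (𝓝 0) := by
  have hadd : Tendsto (fun w : ℂ => 1 + w) (𝓝[≠] 0) (𝓝 1) :=
    (Continuous.tendsto' (by fun_prop) 0 1 (by simp)).mono_left nhdsWithin_le_nhds
  have hprod := ((hχ 0).tendsto_punctured.mul ((hχ 1).tendsto_div hφ (hb 1))).mul hadd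
  rw [zero_mul, zero_mul] at hprod
  exact hprod.congr fun w => by ring

theorem IsInversePsi.eventually_one_add_ne_zero (hφ : φ 1 = 1) {b : A} {χ : ℂ → ℂ}
    (hχ : IsInversePsi φ b χ) : ∀ᶠ w : ℂ in 𝓝[≠] 0, 1 + w ≠ 0 := by
  filter_upwards [hχ.eventually_psi_eq, hχ.eventually_isRegular hφ] with w hw hreg
  rw [← hw, one_add_psi]
  exact hreg.map_ne_zero

theorem IsBiFree.eventually_psi_mul (hφ : φ 1 = 1)
    (h : IsBiFree.{u, v, 0} (φ : A →ₗ[ℂ] ℂ) a b) (hb : ∀ k, φ (b k) ≠ 0)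
    (hχ : ∀ k, IsInversePsi φ (b k) (χ k)) :
    ∀ᶠ w in 𝓝[≠] 0, psi φ (b 0 * b 1) (χ 0 w * χ 1 w * ((1 + w) / w)) = w := by
  filter_upwards [eventually_all.2 fun k => (hχ k).eventually_psi_eq,
    eventually_all.2 fun k => (hχ k).eventually_isRegular hφ,
    (hχ 0).eventually_one_add_ne_zero hφ,
    eventually_norm_lt_one (tendsto_smul_right_deviation_mul hφ hb hχ), self_mem_nhdsWithin]
    with w hψ hreg hw1 hsmall (hw : w ≠ 0)
  have hβ := (h.hasDiagonalMoments hφ (α := fun _ => 0) (fun k => zero_mem _)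
    fun k => (hreg k).deviation_mem_centred hφ).map_altSeries_mul_altSeries (by simp) hsmall
    (by simp)
  simp only [altSeries_zero, one_mul, zero_mul, map_zero] at hβ
  rw [psi, ringInverse_one_sub_mul hw hw1 hreg hψ, map_smul, hβ, smul_eq_mul, mul_one,
    add_sub_cancel_left]

end SumsAndProducts

section Transform

variable {A : Type u} [NormedRing A] [NormedAlgebra ℂ A] [CompleteSpace A] {φ : A →L[ℂ] ℂ}

theorem tendsto_deviationMoment (hφ : φ 1 = 1) {a b : A} {K χ : ℂ → ℂ} (hK : IsInverseG φ a K)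
    (hχ : IsInversePsi φ b χ) :
    Tendsto (fun p : ℂ × ℂ => deviationMoment φ a b (K p.1) (χ p.2))
      (𝓝[≠] 0 ×ˢ 𝓝[≠] 0) (𝓝 0) := by
  have hprod := ((hK.tendsto_deviation hφ).comp tendsto_fst).mul
    ((hχ.tendsto_deviation hφ).comp tendsto_snd)
  simpa [Function.comp_def, deviationMoment] using (φ.continuous.tendsto _).comp hprod

theorem tendsto_mul_deviationMoment (hφ : φ 1 = 1) {a b : A} {K χ : ℂ → ℂ} (hb : φ b ≠ 0)
    (hK : IsInverseG φ a K) (hχ : IsInversePsi φ b χ) :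
    Tendsto (fun p : ℂ × ℂ => (1 + p.2) / p.2 * deviationMoment φ a b (K p.1) (χ p.2))
      (𝓝[≠] 0 ×ˢ 𝓝[≠] 0) (𝓝 0) := by
  have hprod := ((hK.tendsto_deviation hφ).comp tendsto_fst).mul
    ((hχ.tendsto_smul_deviation hφ hb).comp tendsto_snd)
  simpa [Function.comp_def, deviationMoment] using (φ.continuous.tendsto _).comp hprod

theorem eventually_mixedF_eq (hφ : φ 1 = 1) {a b : A} {K χ : ℂ → ℂ} (hK : IsInverseG φ a K)
    (hχ : IsInversePsi φ b χ) :
    ∀ᶠ p : ℂ × ℂ in 𝓝[≠] 0 ×ˢ 𝓝[≠] 0, mixedF φ a b (K p.1) (χ p.2) =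
      p.1 * (1 + p.2) * (1 + deviationMoment φ a b (K p.1) (χ p.2)) := by
  filter_upwards [(hK.2.and (hK.eventually_ne_zero.and (hK.eventually_isRegular hφ))).prod_mk
    (hχ.eventually_psi_eq.and (hχ.eventually_isRegular hφ))]
    with p ⟨⟨hG, hK0, ha⟩, hψ, hb⟩
  rw [ha.mixedF_eq hb hφ hK0, hG, hψ]

variable {a b : Fin 2 → A} {K χ : Fin 2 → ℂ → ℂ}

theorem tendsto_smul_deviationMoment_mul (hφ : φ 1 = 1) (hb : ∀ k, φ (b k) ≠ 0)
    (hK : ∀ k, IsInverseG φ (a k) (K k)) (hχ : ∀ k, IsInversePsi φ (b k) (χ k)) :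
    Tendsto (fun p : ℂ × ℂ => ((1 + p.2) / p.2) •
        (deviationMoment φ (a 0) (b 0) (K 0 p.1) (χ 0 p.2) *
          deviationMoment φ (a 1) (b 1) (K 1 p.1) (χ 1 p.2)))
      (𝓝[≠] 0 ×ˢ 𝓝[≠] 0) (𝓝 0) := by
  simpa [mul_assoc] using (tendsto_mul_deviationMoment hφ (hb 0) (hK 0) (hχ 0)).mul
    (tendsto_deviationMoment hφ (hK 1) (hχ 1))

theorem IsBiFree.eventually_mixedF_add_mul (hφ : φ 1 = 1)
    (h : IsBiFree.{u, v, 0} (φ : A →ₗ[ℂ] ℂ) a b) (hb : ∀ k, φ (b k) ≠ 0)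
    (hK : ∀ k, IsInverseG φ (a k) (K k)) (hχ : ∀ k, IsInversePsi φ (b k) (χ k)) :
    ∀ᶠ p : ℂ × ℂ in 𝓝[≠] 0 ×ˢ 𝓝[≠] 0,
      mixedF φ (a 0 + a 1) (b 0 * b 1) (K 0 p.1 + K 1 p.1 - p.1⁻¹)
        (χ 0 p.2 * χ 1 p.2 * ((1 + p.2) / p.2)) =
      p.1 * (1 + p.2) * altSeries ((1 + p.2) / p.2) fun k =>
        deviationMoment φ (a k) (b k) (K k p.1) (χ k p.2) := by
  filter_upwards [tendsto_fst.eventually (eventually_all.2 fun k => (hK k).2),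
    tendsto_fst.eventually (eventually_all.2 fun k => (hK k).eventually_ne_zero),
    tendsto_fst.eventually (eventually_all.2 fun k => (hK k).eventually_isRegular hφ),
    tendsto_fst.eventually
      (eventually_norm_lt_one (tendsto_left_deviation_mul hφ hK)),
    tendsto_snd.eventually (eventually_all.2 fun k => (hχ k).eventually_psi_eq),
    tendsto_snd.eventually (eventually_all.2 fun k => (hχ k).eventually_isRegular hφ),
    tendsto_snd.eventually ((hχ 0).eventually_one_add_ne_zero hφ),
    tendsto_snd.eventually
      (eventually_norm_lt_one (tendsto_smul_right_deviation_mul hφ hb hχ)),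
    eventually_norm_lt_one (tendsto_smul_deviationMoment_mul hφ hb hK hχ),
    tendsto_fst.eventually self_mem_nhdsWithin, tendsto_snd.eventually self_mem_nhdsWithin]
    with p hG hK0 ha hα hψ hb hw1 hβ hαβ hz hw
  rw [mixedF, ringInverse_sub_add hz ha hK0 hG, ringInverse_one_sub_mul hw hw1 hb hψ,
    smul_mul_smul_comm, map_smul, smul_eq_mul,
    (h.hasDiagonalMoments hφ (fun k => (ha k).deviation_mem_centred hφ)
      fun k => (hb k).deviation_mem_centred hφ).map_altSeries_mul_altSeries hα hβ hαβ]
  rfl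

theorem add_one_div_mul_one_sub_div {z w f : ℂ} (hz : z ≠ 0) (hw : w ≠ 0) (hw1 : 1 + w ≠ 0)
    (hf : f ≠ 0) :
    (w + 1) / w * (1 - z / (z * (1 + w) * f)) = (1 + (1 + w) / w * (f - 1)) / f := by
  field_simp
  ring

theorem altSeries_eq_div (c : ℂ) (P : Fin 2 → ℂ) :
    altSeries c P = (1 + P 0) * (1 + P 1) / (1 - c * (P 0 * P 1)) := by
  rw [altSeries, smul_eq_mul, Ring.inverse_eq_inv']
  ring

theorem one_add_mul_altSeries_sub_one_div {c : ℂ} {P : Fin 2 → ℂ}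
    (hden : 1 - c * (P 0 * P 1) ≠ 0) :
    (1 + c * (altSeries c P - 1)) / altSeries c P =
      (1 + c * (1 + P 0 - 1)) / (1 + P 0) * ((1 + c * (1 + P 1 - 1)) / (1 + P 1)) := by
  have hnum : 1 + c * (altSeries c P - 1) =
      (1 + c * P 0) * (1 + c * P 1) / (1 - c * (P 0 * P 1)) := by
    rw [altSeries_eq_div, eq_div_iff hden, add_mul, mul_assoc, sub_mul, div_mul_cancel₀ _ hden]
    ring
  rw [hnum, altSeries_eq_div, div_div_div_cancel_right₀ hden, add_sub_cancel_left,
    add_sub_cancel_left, div_mul_div_comm]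

theorem IsBiFree.eventually_transform_add_mul (hφ : φ 1 = 1)
    (h : IsBiFree.{u, v, 0} (φ : A →ₗ[ℂ] ℂ) a b) (hb : ∀ k, φ (b k) ≠ 0)
    (hK : ∀ k, IsInverseG φ (a k) (K k)) (hχ : ∀ k, IsInversePsi φ (b k) (χ k))
    {K' χ' : ℂ → ℂ} (hK' : IsInverseG φ (a 0 + a 1) K')
    (hχ' : IsInversePsi φ (b 0 * b 1) χ') :
    ∀ᶠ p : ℂ × ℂ in 𝓝[≠] 0 ×ˢ 𝓝[≠] 0,
      (p.2 + 1) / p.2 * (1 - p.1 / mixedF φ (a 0 + a 1) (b 0 * b 1) (K' p.1) (χ' p.2)) =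
        (p.2 + 1) / p.2 * (1 - p.1 / mixedF φ (a 0) (b 0) (K 0 p.1) (χ 0 p.2)) *
          ((p.2 + 1) / p.2 * (1 - p.1 / mixedF φ (a 1) (b 1) (K 1 p.1) (χ 1 p.2))) := by
  have hb' : φ (b 0 * b 1) ≠ 0 :=
    (h.map_mul_right hφ zero_ne_one).trans_ne (mul_ne_zero (hb 0) (hb 1))
  have hadd := hK'.eventuallyEq hφ (h.isInverseG_add hφ hK)
  have hmul := hχ'.eventuallyEq hb' (tendsto_inversePsi_mul hφ hb hχ)
    (h.eventually_psi_mul hφ hb hχ)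
  have hne (k : Fin 2) : ∀ᶠ p : ℂ × ℂ in 𝓝[≠] 0 ×ˢ 𝓝[≠] 0,
      1 + deviationMoment φ (a k) (b k) (K k p.1) (χ k p.2) ≠ 0 :=
    ((tendsto_deviationMoment hφ (hK k) (hχ k)).const_add 1).eventually_ne (by simp)
  filter_upwards [tendsto_fst.eventually hadd, tendsto_snd.eventually hmul,
    h.eventually_mixedF_add_mul hφ hb hK hχ,
    eventually_all.2 fun k => eventually_mixedF_eq hφ (hK k) (hχ k), eventually_all.2 hne,
    eventually_norm_lt_one (tendsto_smul_deviationMoment_mul hφ hb hK hχ),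
    tendsto_snd.eventually ((hχ 0).eventually_one_add_ne_zero hφ),
    tendsto_fst.eventually self_mem_nhdsWithin, tendsto_snd.eventually self_mem_nhdsWithin]
    with p hp_add hp_mul hF hFk hP hsmall hw1 (hz : p.1 ≠ 0) (hw : p.2 ≠ 0)
  let P (k : Fin 2) := deviationMoment φ (a k) (b k) (K k p.1) (χ k p.2)
  have hden : 1 - (1 + p.2) / p.2 * (P 0 * P 1) ≠ 0 :=
    (isUnit_one_sub_of_norm_lt_one hsmall).ne_zero
  have hf : altSeries ((1 + p.2) / p.2) P ≠ 0 :=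
    altSeries_eq_div _ P ▸ div_ne_zero (mul_ne_zero (hP 0) (hP 1)) hden
  rw [hp_add, hp_mul, hF, hFk 0, hFk 1, add_one_div_mul_one_sub_div hz hw hw1 hf,
    add_one_div_mul_one_sub_div hz hw hw1 (hP 0), add_one_div_mul_one_sub_div hz hw hw1 (hP 1),
    one_add_mul_altSeries_sub_one_div hden]

theorem isInverseG_invG (hφ : φ 1 = 1) (a : A) : IsInverseG φ a (invG φ hφ a) :=
  (exists_isInverseG φ hφ a).choose_spec

theorem isInversePsi_invPsi (hφ : φ 1 = 1) {b : A} (hb : φ b ≠ 0) :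
    IsInversePsi φ b (invPsi φ hφ b hb) :=
  (exists_isInversePsi φ hφ b hb).choose_spec

end Transform

end BiFree

theorem theorem3p1 {A : Type u} [NormedRing A] [NormedAlgebra ℂ A] [CompleteSpace A]
    (φ : A →L[ℂ] ℂ) (hφ : φ 1 = 1) (a₁ b₁ a₂ b₂ : A)
    (hfree : BiFree.IsBiFree.{u, v, 0} (φ : A →ₗ[ℂ] ℂ) ![a₁, a₂] ![b₁, b₂])
    (hb₁ : φ b₁ ≠ 0) (hb₂ : φ b₂ ≠ 0) :
    ∃ hb : φ (b₁ * b₂) ≠ 0, ∀ᶠ p : ℂ × ℂ in 𝓝 (0, 0), p.1 ≠ 0 → p.2 ≠ 0 →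
      BiFree.tTransform φ hφ (a₁ + a₂) (b₁ * b₂) hb p.1 p.2 =
        BiFree.tTransform φ hφ a₁ b₁ hb₁ p.1 p.2 * BiFree.tTransform φ hφ a₂ b₂ hb₂ p.1 p.2 := by
  have hne : ∀ k, φ (![b₁, b₂] k) ≠ 0 := Fin.forall_fin_two.2 ⟨hb₁, hb₂⟩
  have hb : φ (b₁ * b₂) ≠ 0 :=
    (hfree.map_mul_right hφ zero_ne_one).trans_ne (mul_ne_zero hb₁ hb₂)
  have hT := hfree.eventually_transform_add_mul hφ hne
    (fun k => BiFree.isInverseG_invG hφ (![a₁, a₂] k))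
    (fun k => BiFree.isInversePsi_invPsi hφ (hne k))
    (BiFree.isInverseG_invG hφ (a₁ + a₂)) (BiFree.isInversePsi_invPsi hφ hb)
  rw [← nhdsWithin_prod_eq, eventually_nhdsWithin_iff] at hT
  refine ⟨hb, ?_⟩
  filter_upwards [hT] with p hp hz hw using hp ⟨hz, hw⟩
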